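/- Let $n\ge 1$, $r\ge 1$ and let $\mathbf r=(i_1,\dots,i_r)$ be integers with $1\le i_1<\dots<i_r\le n-1$; put $i_0=0$, $i_{r+1}=n$. Let $F^n_{\mathbf r}$ be the manifold of flags $\xi=(F_1\subset\dots\subset F_r)$ of linear subspaces of $\mathbb R^n$ with $\dim F_j=i_j$, equipped with its unique $SO_n$-invariant (Haar) probability measure $d\xi$. For $L\subseteq\mathbb R^n$ let $$\Phi_{\mathbf r}(L)=\Big(\int_{F^n_{\mathbf r}}\prod_{j=1}^r |P_{F_j}L|^{\,i_{j-1}-i_{j+1}}\,d\xi\Big)^{-\frac1{i_r n}}\in[0,\infty],$$ where $P_F$ is the orthogonal projection onto $F$ and $|P_FL|$ is the $\dim F$-dimensional volume of $P_FL$, and for $f:\mathbb R^n\to[0,\infty]$ let $$\Phi_{\mathbf r}(f)=\int_0^\infty \Phi_{\mathbf r}(\{x: f(x)\ge t\})\,dt\in[0,\infty].$$ (Negative powers are taken in $[0,\infty]$ with $0^{-a}=\infty$ and $\infty^{-a}=0$ for $a>0$. If the sets $\{f\ge t\}$, $t>0$, are compact, all sets and integrands involved are measurable; for general $f$, $|\cdot|$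 denotes outer Lebesgue measure, $0\cdot\infty=0$, and the integral of a non-negative function is the supremum of the integrals of the measurable functions below it.) **Theorem.** Let $f:\mathbb R^n\to[0,\infty]$. For every $\lambda>0$, with $f_{(\lambda)}(x):=f(x/\lambda)$, $$\Phi_{\mathbf r}(f_{(\lambda)})=\lambda\,\Phi_{\mathbf r}(f),$$ and for every volume-preserving affine bijection $T$ of $\mathbb R^n$, with the convention $(f\circ T)(x):=f(T^{-1}x)$, $$\Phi_{\mathbf r}(f\circ T)=\Phi_{\mathbf r}(f).$$ -/

import Mathlib

open MeasureTheory

noncomputable section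

namespace FlagQuermass

/-- Euclidean space `ℝⁿ`. -/
abbrev E (n : ℕ) : Type := EuclideanSpace ℝ (Fin n)

/-! ### Index sequences -/

/-- A strictly increasing sequence `1 ≤ i₁ < ⋯ < i_r ≤ n - 1` of integers.  Positions are counted
from `0`, so `idx j` is the index `i_{j+1}` of the usual notation. -/
structure FlagIndex (n r : ℕ) where
  idx : Fin r → ℕ
  strictMono : StrictMono idx
  one_le : ∀ j, 1 ≤ idx j
  lt : ∀ j, idx j < n

/-- The extended sequence `i₀ = 0, i₁, …, i_r, i_{r+1} = n`. -/
def FlagIndex.ext {n r : ℕ} (I : FlagIndex n r) (k : ℕ) : ℕ :=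
  if k = 0 then 0 else if h : k - 1 < r then I.idx ⟨k - 1, h⟩ else n

/-! ### The flag manifold -/

/-- The flag manifold: all `F₁ ⊆ ⋯ ⊆ F_r` with `dim F_j = i_j`. -/
@[ext] structure Flag {n r : ℕ} (I : FlagIndex n r) where
  space : Fin r → Submodule ℝ (E n)
  finrank_eq : ∀ j, Module.finrank ℝ (space j) = I.idx j
  mono : Monotone space

/-- The usual topology of the flag manifold: a subspace is identified with the orthogonal
projection onto it. -/
instance {n r : ℕ} (I : FlagIndex n r) : TopologicalSpace (Flag I) :=
  TopologicalSpace.induced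
    (fun ξ (j : Fin r) => ((ξ.space j).starProjection : E n →L[ℝ] E n)) inferInstance

/-- The flag manifold carries its Borel `σ`-algebra. -/
instance {n r : ℕ} (I : FlagIndex n r) : MeasurableSpace (Flag I) := borel _

instance {n r : ℕ} (I : FlagIndex n r) : BorelSpace (Flag I) := ⟨rfl⟩

/-! ### The special orthogonal group, its Haar measure and its action on flags -/

/-- The special orthogonal group `SO_n`, with the topology of real matrices. -/
abbrev SO (n : ℕ) : Type := Matrix.specialOrthogonalGroup (Fin n) ℝ

instance (n : ℕ) : MeasurableSpace (SO n) := borel _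

instance (n : ℕ) : BorelSpace (SO n) := ⟨rfl⟩

instance (n : ℕ) : IsTopologicalGroup (SO n) where
  continuous_mul := Continuous.subtype_mk
    ((continuous_subtype_val.comp continuous_fst).mul
      (continuous_subtype_val.comp continuous_snd)) _
  continuous_inv := Continuous.subtype_mk (continuous_subtype_val.star) _

instance (n : ℕ) : CompactSpace (SO n) := by
  refine (isCompact_iff_compactSpace (s := (Matrix.specialOrthogonalGroup (Fin n) ℝ :
    Set (Matrix (Fin n) (Fin n) ℝ)))).mp ?_
  have hc : IsClosed ((Matrix.specialOrthogonalGroup (Fin n) ℝ : Set (Matrix (Fin n) (Fin n) ℝ))) := by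
    have h1 : IsClosed ((unitary (Matrix (Fin n) (Fin n) ℝ) : Set (Matrix (Fin n) (Fin n) ℝ))) :=
      isClosed_unitary
    have h2 : IsClosed {A : Matrix (Fin n) (Fin n) ℝ | A.det = 1} :=
      isClosed_eq (Continuous.matrix_det continuous_id) continuous_const
    have h3 : (Matrix.specialOrthogonalGroup (Fin n) ℝ : Set (Matrix (Fin n) (Fin n) ℝ)) =
        (unitary (Matrix (Fin n) (Fin n) ℝ) : Set (Matrix (Fin n) (Fin n) ℝ)) ∩
          {A | A.det = 1} := rfl
    rw [h3]
    exact h1.inter h2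
  have hK : IsCompact (Set.univ.pi fun _ : Fin n => Set.univ.pi fun _ : Fin n =>
      Set.Icc (-1 : ℝ) 1) :=
    isCompact_univ_pi fun _ => isCompact_univ_pi fun _ => isCompact_Icc
  refine hK.of_isClosed_subset hc ?_
  intro A hA i _ j _
  have := entry_norm_bound_of_unitary (𝕜 := ℝ) hA.1 i j
  exact abs_le.mp this

/-- The Haar probability measure of `SO_n`. -/
def haarSO (n : ℕ) : Measure (SO n) := Measure.haarMeasure ⊤

instance (n : ℕ) : (haarSO n).IsHaarMeasure := by
  unfold haarSO; infer_instance

instance (n : ℕ) : IsProbabilityMeasure (haarSO n) :=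
  ⟨by simpa [haarSO] using Measure.haarMeasure_self (K₀ := (⊤ : TopologicalSpace.PositiveCompacts (SO n)))⟩

/-- The isometry `x ↦ g x` of `ℝⁿ` given by `g ∈ SO_n`. -/
def rot {n : ℕ} (g : SO n) : E n ≃ₗᵢ[ℝ] E n where
  toFun x := Matrix.toEuclideanCLM (𝕜 := ℝ) g.1 x
  map_add' := by simp
  map_smul' := by simp
  invFun x := Matrix.toEuclideanCLM (𝕜 := ℝ) (g⁻¹).1 x
  left_inv x := by
    have h : (g⁻¹).1 * g.1 = 1 := congrArg Subtype.val (inv_mul_cancel g)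
    change (Matrix.toEuclideanCLM (𝕜 := ℝ) (g⁻¹).1 * Matrix.toEuclideanCLM (𝕜 := ℝ) g.1) x = x
    rw [← map_mul, h, map_one]; rfl
  right_inv x := by
    have h : g.1 * (g⁻¹).1 = 1 := congrArg Subtype.val (mul_inv_cancel g)
    change (Matrix.toEuclideanCLM (𝕜 := ℝ) g.1 * Matrix.toEuclideanCLM (𝕜 := ℝ) (g⁻¹).1) x = x
    rw [← map_mul, h, map_one]; rfl
  norm_map' x := by
    change ‖Matrix.toEuclideanCLM (𝕜 := ℝ) g.1 x‖ = ‖x‖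
    have h : star g.1 * g.1 = 1 := congrArg Subtype.val (inv_mul_cancel g)
    have h2 : star (Matrix.toEuclideanCLM (𝕜 := ℝ) g.1) * Matrix.toEuclideanCLM (𝕜 := ℝ) g.1
        = 1 := by
      rw [← map_star, ← map_mul, h, map_one]
    have h3 := ContinuousLinearMap.apply_norm_sq_eq_inner_adjoint_left
      (Matrix.toEuclideanCLM (𝕜 := ℝ) g.1) x
    rw [← ContinuousLinearMap.star_eq_adjoint, ← ContinuousLinearMap.mul_def, h2] at h3
    have h4 : ‖Matrix.toEuclideanCLM (𝕜 := ℝ) g.1 x‖ ^ 2 = ‖x‖ ^ 2 := by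
      simpa using h3
    exact (sq_eq_sq₀ (norm_nonneg _) (norm_nonneg _)).mp h4

/-- `SO_n` acts on flags by `g • (F₁, …, F_r) = (g F₁, …, g F_r)`. -/
instance {n r : ℕ} (I : FlagIndex n r) : SMul (SO n) (Flag I) where
  smul g ξ :=
    { space := fun j => (ξ.space j).map (rot g).toLinearEquiv.toLinearMap
      finrank_eq := fun j =>
        (LinearEquiv.finrank_map_eq (rot g).toLinearEquiv (ξ.space j)).trans (ξ.finrank_eq j)
      mono := fun _ _ h => Submodule.map_mono (ξ.mono h) }

/-- The standard flag: `F_j` is spanned by the first `i_j` vectors of the standard basis. -/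
def stdFlag {n r : ℕ} (I : FlagIndex n r) : Flag I where
  space j := Submodule.span ℝ (Set.range fun k : Fin (I.idx j) =>
    (EuclideanSpace.single (Fin.castLE (I.lt j).le k) (1 : ℝ) : E n))
  finrank_eq j := by
    have h : LinearIndependent ℝ fun k : Fin (I.idx j) =>
        (EuclideanSpace.single (Fin.castLE (I.lt j).le k) (1 : ℝ) : E n) := by
      have := (EuclideanSpace.basisFun (Fin n) ℝ).orthonormal.linearIndependent.comp
        (Fin.castLE (I.lt j).le) (Fin.castLE_injective _)
      have he : (fun k : Fin (I.idx j) =>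
          (EuclideanSpace.single (Fin.castLE (I.lt j).le k) (1 : ℝ) : E n)) =
          (EuclideanSpace.basisFun (Fin n) ℝ) ∘ Fin.castLE (I.lt j).le := by
        funext k
        simp
      rw [he]
      exact this
    rw [finrank_span_eq_card h, Fintype.card_fin]
  mono a b hab := by
    refine Submodule.span_mono ?_
    rintro _ ⟨k, rfl⟩
    exact ⟨Fin.castLE (I.strictMono.monotone hab) k, rfl⟩

/-- The Haar probability measure of the flag manifold, that is, its unique Borel probability
measure which is invariant under `SO_n`: the image of the Haar probability measure of `SO_n` under
the orbit map of the standard flag (the action on flags is transitive). -/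
def flagMeasure {n r : ℕ} (I : FlagIndex n r) : Measure (Flag I) :=
  (haarSO n).map fun g => g • stdFlag I

theorem mul_smul_flag {n r : ℕ} {I : FlagIndex n r} (g h : SO n) (ξ : Flag I) :
    (g * h) • ξ = g • h • ξ := by
  ext1
  funext j
  change (ξ.space j).map _ = ((ξ.space j).map _).map _
  rw [← Submodule.map_comp]
  congr 1
  ext1 x
  change Matrix.toEuclideanCLM (𝕜 := ℝ) (g.1 * h.1) x = _
  rw [map_mul]
  rfl

theorem starProjection_smul {n r : ℕ} {I : FlagIndex n r} (g : SO n) (ξ : Flag I) (j : Fin r) :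
    ((g • ξ).space j).starProjection =
      Matrix.toEuclideanCLM (𝕜 := ℝ) g.1 * (ξ.space j).starProjection *
        Matrix.toEuclideanCLM (𝕜 := ℝ) (g⁻¹).1 := by
  ext1 x
  exact Submodule.starProjection_map_apply (rot g) (ξ.space j) x

theorem continuous_toEuclideanCLM (n : ℕ) :
    Continuous fun A : Matrix (Fin n) (Fin n) ℝ => Matrix.toEuclideanCLM (𝕜 := ℝ) A :=
  LinearMap.continuous_of_finiteDimensional
    (Matrix.toEuclideanCLM (n := Fin n) (𝕜 := ℝ)).toAlgEquiv.toLinearMap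

theorem continuous_smul_flag {n r : ℕ} {I : FlagIndex n r} :
    Continuous fun p : SO n × Flag I => p.1 • p.2 := by
  refine continuous_induced_rng.mpr (continuous_pi fun j => ?_)
  simp only [Function.comp_def, starProjection_smul]
  have h1 : Continuous fun p : SO n × Flag I => Matrix.toEuclideanCLM (𝕜 := ℝ) p.1.1 :=
    (continuous_toEuclideanCLM n).comp (continuous_subtype_val.comp continuous_fst)
  have h2 : Continuous fun p : SO n × Flag I => Matrix.toEuclideanCLM (𝕜 := ℝ) (p.1⁻¹).1 :=
    (continuous_toEuclideanCLM n).comp (continuous_subtype_val.comp continuous_fst.inv)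
  have h3 : Continuous fun p : SO n × Flag I =>
      ((p.2.space j).starProjection : E n →L[ℝ] E n) :=
    (continuous_apply (A := fun _ : Fin r => E n →L[ℝ] E n) j).comp
      ((continuous_induced_dom (f := fun (ξ : Flag I) (j : Fin r) =>
        ((ξ.space j).starProjection : E n →L[ℝ] E n))).comp continuous_snd)
  exact (h1.mul h3).mul h2

theorem measurable_orbit {n r : ℕ} {I : FlagIndex n r} (ξ : Flag I) :
    Measurable fun g : SO n => g • ξ :=
  (continuous_smul_flag.comp (continuous_id.prodMk continuous_const)).measurable

instance {n r : ℕ} (I : FlagIndex n r) : IsProbabilityMeasure (flagMeasure I) :=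
  Measure.isProbabilityMeasure_map (measurable_orbit _).aemeasurable

/-- The flag measure is invariant under `SO_n`. -/
theorem map_smul_flagMeasure {n r : ℕ} (I : FlagIndex n r) (g : SO n) :
    (flagMeasure I).map (fun ξ => g • ξ) = flagMeasure I := by
  have hg : Measurable fun ξ : Flag I => g • ξ :=
    (continuous_smul_flag.comp (continuous_const.prodMk continuous_id)).measurable
  have hl : Measurable fun h : SO n => g * h := (continuous_const_mul g).measurable
  unfold flagMeasure
  rw [Measure.map_map hg (measurable_orbit _)]
  conv_rhs => rw [← map_mul_left_eq_self (haarSO n) g]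
  rw [Measure.map_map (measurable_orbit _) hl]
  congr 1
  funext h
  exact (mul_smul_flag g h _).symm

/-! ### The functionals -/

/-- `|P_F L|`: the `dim F`-dimensional volume of the orthogonal projection of `L` onto `F`
(Lebesgue outer measure if the projection is not measurable, which cannot happen for compact
`L`). -/
def projVol {n : ℕ} (F : Submodule ℝ (E n)) (L : Set (E n)) : ENNReal :=
  (volume : Measure F) (F.orthogonalProjectionOnto '' L)

/-- The flag quermassintegral of a set,
`(∫ ∏_{j=1}^r |P_{F_j} L| ^ (i_{j-1} - i_{j+1}) dξ) ^ (-1 / (i_r n))`, with values in `[0, ∞]`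
(`0` to a negative power is `∞`, and `∞` to a negative power is `0`). The factor at the position
`j : Fin r` is the one with number `j + 1`. -/
def flagQuermass {n r : ℕ} (I : FlagIndex n r) (L : Set (E n)) : ENNReal :=
  (∫⁻ ξ : Flag I, ∏ j : Fin r,
      projVol (ξ.space j) L ^ ((I.ext j : ℝ) - (I.ext (j + 2) : ℝ)) ∂(flagMeasure I)) ^
    (-(1 / ((I.ext r : ℝ) * (n : ℝ))))

/-- The flag quermassintegral of a function, `∫₀^∞ Φ({f ≥ t}) dt`. -/
def flagQuermassFun {n r : ℕ} (I : FlagIndex n r) (f : E n → ENNReal) : ENNReal :=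
  ∫⁻ t in Set.Ioi (0 : ℝ), flagQuermass I {x | ENNReal.ofReal t ≤ f x}

/-- `f_(lam) (x) = f (x / lam)`. -/
def dilate {n : ℕ} (lam : ℝ) (f : E n → ENNReal) : E n → ENNReal :=
  fun x => f (lam⁻¹ • x)

/-- `f ∘ T` in the convention `(f ∘ T) (x) = f (T⁻¹ x)`, for which `1_K ∘ T = 1_{T K}`. -/
def affComp {n : ℕ} (f : E n → ENNReal) (T : E n ≃ᵃ[ℝ] E n) : E n → ENNReal :=
  fun x => f (T.symm x)

end FlagQuermass

end

/-! The dilation rule is a degree count. By a telescoping sum the integrand is homogeneous of degree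
`-(i_r n)`, and the outer exponent turns this into degree one. Superlevel sets of `f_(λ)` and `f ∘
T` are images of those of `f`, so everything reduces to sets. Translations only translate the
projections.

The substance is invariance under a linear map of determinant `±1`, written as an adjoint `h*`.
Since `P_F h*` is the adjoint of `h : F → hF` applied after `P_{hF}`, one has `|P_F h*L| = jac F h ·
|P_{hF} L|` (`projVol_adjoint_image`). The integrand of `h*L` at `ξ` is therefore `flagJac h ξ`
times the integrand of `L` at `hξ`, and what remains is that `flagJac h` is the density of `dξ`
under `ξ ↦ hξ` (`lintegral_flagJac_mul`).

This is shown without charts, on the quotient `G/P` of `G = GL_n` by the stabiliser `P` of the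
standard flag. A weight `w` on `G` with `w(xp) Δ(p) = w(x)`, where `Δ` is the modulus of `P`, makes
`1_C w dx` induce the same measure on `G/P` as its translates of `C`, for a bounded
rotation-invariant `C` (`lintegral_translate_indicator_eq`). As `G = SO_n · P`, that measure is a
multiple of `dξ` (`lintegral_frames`). Computing `Δ` from determinants of multiplication operators
shows that `flagWeight` is such a `w` (`unitsModulus_parabolic`), and the chain rule gives `flagJac
h (u ξ₀) w(u) = w(hu)` for the standard flag `ξ₀`. -/

noncomputable section

open MeasureTheory

set_option linter.unusedSectionVars false

namespace FlagQuermass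

section

/-! ### Haar measure on the units of a finite dimensional algebra -/

section UnitsHaar

variable {A : Type*} [NormedRing A] [NormedAlgebra ℝ A] [MeasurableSpace A] [BorelSpace A]
  [CompleteSpace A]

instance borelSpace_units : BorelSpace Aˣ :=
  ⟨by
    rw [Units.isOpenEmbedding_val.isEmbedding.eq_induced, borel_comap,
      ← BorelSpace.measurable_eq (α := A)]
    rfl⟩

theorem measurableEmbedding_units_val : MeasurableEmbedding (Units.val : Aˣ → A) :=
  Units.isOpenEmbedding_val.measurableEmbedding

variable [FiniteDimensional ℝ A]

instance secondCountableTopology_units : SecondCountableTopology Aˣ :=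
  have : SecondCountableTopology A := by
    have : ProperSpace A := FiniteDimensional.proper ℝ A
    infer_instance
  Units.isOpenEmbedding_val.isEmbedding.secondCountableTopology

variable (A) in
/-- The additive Haar measure of a finite dimensional algebra, restricted to its units. -/
def unitsVolume : Measure Aˣ := (Measure.addHaar : Measure A).comap Units.val

instance : IsFiniteMeasureOnCompacts (unitsVolume A) :=
  .comap' _ Units.continuous_val measurableEmbedding_units_val

instance : SFinite (unitsVolume A) := by
  have : ProperSpace A := FiniteDimensional.proper ℝ A
  have : LocallyCompactSpace Aˣ := Units.isOpenEmbedding_val.locallyCompactSpace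
  infer_instance

/-- The linear change of variables formula, restricted to the open set of units. Since `e` is a
measurable equivalence, `f` may be arbitrary. -/
theorem lintegral_unitsVolume_comp (e : Aˣ ≃ᵐ Aˣ) (l : A →ₗ[ℝ] A) (hl : LinearMap.det l ≠ 0)
    (hel : ∀ u : Aˣ, ((e u : Aˣ) : A) = l u) (f : Aˣ → ENNReal) :
    ∫⁻ u, f (e u) ∂(unitsVolume A) =
      ENNReal.ofReal |(LinearMap.det l)⁻¹| * ∫⁻ u, f u ∂(unitsVolume A) := by
  have hmap : (unitsVolume A).map e =
      ENNReal.ofReal |(LinearMap.det l)⁻¹| • unitsVolume A := by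
    ext s hs
    rw [e.map_apply, Measure.smul_apply, unitsVolume,
      measurableEmbedding_units_val.comap_apply, measurableEmbedding_units_val.comap_apply,
      smul_eq_mul, ← Measure.addHaar_preimage_linearMap _ hl]
    congr 1
    ext x
    constructor
    · rintro ⟨u, hu, rfl⟩
      exact ⟨e u, hu, hel u⟩
    · rintro ⟨v, hv, hvx⟩
      refine ⟨e.symm v, by simpa using hv, ?_⟩
      have hinj : Function.Injective l :=
        (l.equivOfDetNeZero hl).injective
      apply hinj
      rw [← hel, e.apply_symm_apply, hvx]
  rw [← lintegral_map_equiv f e, hmap, lintegral_smul_measure, smul_eq_mul]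

theorem det_mulLeft_units_ne_zero (u : Aˣ) : LinearMap.det (LinearMap.mulLeft ℝ (u : A)) ≠ 0 := by
  have h : LinearMap.det (LinearMap.mulLeft ℝ (u : A)) *
      LinearMap.det (LinearMap.mulLeft ℝ ((u⁻¹ : Aˣ) : A)) = 1 := by
    rw [← LinearMap.det_comp, ← LinearMap.mulLeft_mul, Units.mul_inv, LinearMap.mulLeft_one,
      LinearMap.det_id]
  exact left_ne_zero_of_mul_eq_one h

theorem det_mulRight_units_ne_zero (u : Aˣ) :
    LinearMap.det (LinearMap.mulRight ℝ (u : A)) ≠ 0 := by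
  have h : LinearMap.det (LinearMap.mulRight ℝ (u : A)) *
      LinearMap.det (LinearMap.mulRight ℝ ((u⁻¹ : Aˣ) : A)) = 1 := by
    rw [← LinearMap.det_comp, ← LinearMap.mulRight_mul, Units.inv_mul, LinearMap.mulRight_one,
      LinearMap.det_id]
  exact left_ne_zero_of_mul_eq_one h

/-- The density of the left Haar measure of the group of units. -/
def unitsDensity (u : Aˣ) : ENNReal :=
  ENNReal.ofReal |(LinearMap.det (LinearMap.mulLeft ℝ (u : A)))⁻¹|

theorem continuous_det_mulLeft :
    Continuous fun a : A => LinearMap.det (LinearMap.mulLeft ℝ a) := by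
  have h2 : Continuous fun a : A => LinearMap.toContinuousLinearMap (LinearMap.mulLeft ℝ a) :=
    LinearMap.continuous_of_finiteDimensional
      (LinearMap.toContinuousLinearMap.toLinearMap ∘ₗ (LinearMap.mul ℝ A))
  exact ContinuousLinearMap.continuous_det.comp h2

theorem measurable_unitsDensity : Measurable (unitsDensity : Aˣ → ENNReal) :=
  ((continuous_det_mulLeft.measurable.comp
    measurableEmbedding_units_val.measurable).inv.norm).ennreal_ofReal

theorem unitsDensity_mul (u v : Aˣ) : unitsDensity (u * v) = unitsDensity u * unitsDensity v := by
  simp only [unitsDensity]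
  rw [← ENNReal.ofReal_mul (abs_nonneg _), ← abs_mul, ← mul_inv, ← LinearMap.det_comp,
    ← LinearMap.mulLeft_mul, Units.val_mul]

theorem unitsDensity_inv_mul (u : Aˣ) : unitsDensity u⁻¹ * unitsDensity u = 1 := by
  rw [← unitsDensity_mul, inv_mul_cancel]
  simp [unitsDensity]

variable (A) in
/-- The left Haar measure of the group of units of a finite dimensional algebra. -/
def unitsHaar : Measure Aˣ := (unitsVolume A).withDensity unitsDensity

instance : SFinite (unitsHaar A) := by unfold unitsHaar; infer_instance

theorem lintegral_unitsHaar (f : Aˣ → ENNReal) :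
    ∫⁻ u, f u ∂(unitsHaar A) = ∫⁻ u, unitsDensity u * f u ∂(unitsVolume A) :=
  lintegral_withDensity_eq_lintegral_mul_non_measurable _ measurable_unitsDensity
    (ae_of_all _ fun _ => ENNReal.ofReal_lt_top) f

/-- The density is multiplicative, so the factor `unitsDensity g⁻¹` it contributes cancels the
Jacobian `unitsDensity g` of the substitution. -/
theorem lintegral_unitsHaar_mul_left (g : Aˣ) (f : Aˣ → ENNReal) :
    ∫⁻ u, f (g * u) ∂(unitsHaar A) = ∫⁻ u, f u ∂(unitsHaar A) := by
  simp only [lintegral_unitsHaar]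
  have h := lintegral_unitsVolume_comp (MeasurableEquiv.mulLeft g) (LinearMap.mulLeft ℝ (g : A))
    (det_mulLeft_units_ne_zero g) (fun u => rfl) (fun u => unitsDensity (g⁻¹ * u) * f u)
  simp only [MeasurableEquiv.coe_mulLeft, inv_mul_cancel_left] at h
  rw [h]
  simp only [unitsDensity_mul, mul_assoc]
  rw [lintegral_const_mul' (unitsDensity g⁻¹) _ ENNReal.ofReal_ne_top, ← mul_assoc, mul_comm (ENNReal.ofReal _),
    show ENNReal.ofReal |(LinearMap.det (LinearMap.mulLeft ℝ (g : A)))⁻¹| = unitsDensity g from rfl,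
    unitsDensity_inv_mul, one_mul]

/-- The factor by which a right translation changes the left Haar measure of the units. -/
def unitsModulus (u : Aˣ) : ENNReal :=
  unitsDensity u⁻¹ * ENNReal.ofReal |(LinearMap.det (LinearMap.mulRight ℝ (u : A)))⁻¹|

theorem lintegral_unitsHaar_mul_right (g : Aˣ) (f : Aˣ → ENNReal) :
    ∫⁻ u, f (u * g) ∂(unitsHaar A) = unitsModulus g * ∫⁻ u, f u ∂(unitsHaar A) := by
  simp only [lintegral_unitsHaar]
  have h := lintegral_unitsVolume_comp (MeasurableEquiv.mulRight g) (LinearMap.mulRight ℝ (g : A))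
    (det_mulRight_units_ne_zero g) (fun u => rfl) (fun u => unitsDensity (u * g⁻¹) * f u)
  simp only [MeasurableEquiv.coe_mulRight, mul_inv_cancel_right] at h
  rw [h]
  simp only [unitsDensity_mul, mul_comm _ (unitsDensity g⁻¹), mul_assoc]
  rw [lintegral_const_mul' (unitsDensity g⁻¹) _ ENNReal.ofReal_ne_top, unitsModulus]
  ring

theorem unitsModulus_mul (u v : Aˣ) : unitsModulus (u * v) = unitsModulus u * unitsModulus v := by
  have h : ENNReal.ofReal |(LinearMap.det (LinearMap.mulRight ℝ ((u * v : Aˣ) : A)))⁻¹| =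
      ENNReal.ofReal |(LinearMap.det (LinearMap.mulRight ℝ (u : A)))⁻¹| *
      ENNReal.ofReal |(LinearMap.det (LinearMap.mulRight ℝ (v : A)))⁻¹| := by
    rw [← ENNReal.ofReal_mul (abs_nonneg _), ← abs_mul, ← mul_inv, mul_comm, ← LinearMap.det_comp,
      ← LinearMap.mulRight_mul, Units.val_mul]
  rw [unitsModulus, unitsModulus, unitsModulus, h, mul_inv_rev, unitsDensity_mul]
  ring

theorem unitsModulus_one : unitsModulus (1 : Aˣ) = 1 := by
  simp [unitsModulus, unitsDensity]

theorem unitsHaar_pos_of_isOpen {s : Set Aˣ} (hs : IsOpen s) (hne : s.Nonempty) :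
    0 < unitsHaar A s := by
  refine pos_iff_ne_zero.mpr fun h0 => ?_
  rw [unitsHaar, withDensity_apply_eq_zero measurable_unitsDensity] at h0
  have h1 : {x : Aˣ | unitsDensity x ≠ 0} ∩ s = s := by
    refine Set.inter_eq_right.mpr fun u _ h => ?_
    have := unitsDensity_inv_mul u
    rw [h, mul_zero] at this
    exact zero_ne_one this
  rw [h1, unitsVolume, measurableEmbedding_units_val.comap_apply] at h0
  exact (Units.isOpenEmbedding_val.isOpenMap s hs).measure_ne_zero _ (hne.image _) h0

/-- A norm bound alone does not suffice: the density blows up near the non-invertible elements. -/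
theorem unitsHaar_lt_top {s : Set Aˣ} (hs : MeasurableSet s) (R : ℝ) (hR : ∀ u ∈ s, ‖(u : A)‖ ≤ R)
    (C : ENNReal) (hC : C ≠ ⊤) (hd : ∀ u ∈ s, unitsDensity u ≤ C) : unitsHaar A s < ⊤ := by
  have : ProperSpace A := FiniteDimensional.proper ℝ A
  rw [unitsHaar, withDensity_apply _ hs]
  calc ∫⁻ u in s, unitsDensity u ∂(unitsVolume A) ≤ ∫⁻ u in s, C ∂(unitsVolume A) :=
        setLIntegral_mono' hs hd
    _ = C * unitsVolume A s := by simp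
    _ < ⊤ := by
      refine ENNReal.mul_lt_top hC.lt_top ?_
      rw [unitsVolume, measurableEmbedding_units_val.comap_apply]
      refine lt_of_le_of_lt (measure_mono (t := Metric.closedBall 0 R) ?_)
        measure_closedBall_lt_top
      rintro _ ⟨u, hu, rfl⟩
      simpa using hR u hu

end UnitsHaar

end

section

/-! ### Determinants of multiplication by a block triangular matrix -/

section BlockTriangularDet

open Matrix

variable {m : Type*} [Fintype m] [LinearOrder m] (b : m → ℕ)

/-- The coordinates of block triangular matrices. -/
def blockEntries : blockTriangularSubalgebra ℝ ℝ b ≃ₗ[ℝ]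
    ({s : m × m // b s.1 ≤ b s.2} → ℝ) where
  toFun M s := M.1 s.1.1 s.1.2
  map_add' _ _ := rfl
  map_smul' _ _ := rfl
  invFun x := ⟨fun i j => if h : b i ≤ b j then x ⟨(i, j), h⟩ else 0, fun i j h => by
    simp [not_le.mpr h]⟩
  left_inv M := by
    ext i j
    by_cases h : b i ≤ b j
    · simp [h]
    · simpa [h] using (M.2 (not_le.mp h)).symm
  right_inv x := by
    ext s
    simp [s.2]

omit [LinearOrder m] in
theorem sum_blockEntries (f : m × m → ℝ) :
    ∑ s : {s : m × m // b s.1 ≤ b s.2}, f s.1 =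
      ∑ i, ∑ j, if b i ≤ b j then f (i, j) else 0 := by
  rw [← Fintype.sum_prod_type' (f := fun i j => if b i ≤ b j then f (i, j) else 0),
    ← Finset.sum_filter]
  exact (Finset.sum_subtype _ (by simp) f).symm

/-- Left multiplication acts on each column separately. Column `k` of a block triangular matrix is
supported on the rows `i` with `b i ≤ b k`, where the action is by the corresponding square block of
`M`. -/
theorem det_mulLeft_blockTriangular (M : blockTriangularSubalgebra ℝ ℝ b) :
    LinearMap.det (LinearMap.mulLeft ℝ M) =
      ∏ k, (toSquareBlockProp M.1 fun i => b i ≤ b k).det := by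
  let N : Matrix {s : m × m // b s.1 ≤ b s.2} {s : m × m // b s.1 ≤ b s.2} ℝ :=
    fun s t => if t.1.2 = s.1.2 then M.1 s.1.1 t.1.1 else 0
  have hconj : (blockEntries b).toLinearMap ∘ₗ LinearMap.mulLeft ℝ M ∘ₗ
      (blockEntries b).symm.toLinearMap = toLin' N := by
    rw [← LinearMap.comp_assoc, LinearEquiv.comp_toLinearMap_symm_eq]
    refine LinearMap.ext fun X => funext fun s => ?_
    change (M.1 * X.1) s.1.1 s.1.2 = ∑ t : {s : m × m // b s.1 ≤ b s.2},
      (if t.1.2 = s.1.2 then M.1 s.1.1 t.1.1 else 0) * X.1 t.1.1 t.1.2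
    rw [sum_blockEntries b fun t => (if t.2 = s.1.2 then M.1 s.1.1 t.1 else 0) * X.1 t.1 t.2,
      mul_apply]
    refine Finset.sum_congr rfl fun i _ => ?_
    rw [Finset.sum_eq_single s.1.2 (fun j _ hj => by simp [hj]) (by simp)]
    by_cases h : b i ≤ b s.1.2
    · simp [h]
    -- Entries of `X` outside the triangular pattern vanish, so summing over the pattern loses
    -- nothing.
    · simp [h, X.2 (not_le.mp h)]
  rw [← LinearMap.det_conj _ (blockEntries b), hconj, LinearMap.det_toLin',
    BlockTriangular.det_fintype (b := fun s => s.1.2)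
      (fun s t hst => by simp [N, hst.ne])]
  refine Finset.prod_congr rfl fun k _ => ?_
  let e : {i // b i ≤ b k} ≃ {s : {s : m × m // b s.1 ≤ b s.2} // s.1.2 = k} :=
    { toFun := fun i => ⟨⟨(i.1, k), i.2⟩, rfl⟩
      invFun := fun s => ⟨s.1.1.1, by have h := s.1.2; rwa [s.2] at h⟩
      left_inv := fun _ => rfl
      right_inv := by rintro ⟨⟨⟨i, j⟩, h⟩, rfl⟩; rfl }
  rw [← det_submatrix_equiv_self e]
  congr 1
  ext i j
  exact if_pos rfl

/-- The same with rows for columns: row `k` is supported on the columns `i` with `b k ≤ b i`. -/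
theorem det_mulRight_blockTriangular (M : blockTriangularSubalgebra ℝ ℝ b) :
    LinearMap.det (LinearMap.mulRight ℝ M) =
      ∏ k, (toSquareBlockProp M.1 fun i => b k ≤ b i).det := by
  let N : Matrix {s : m × m // b s.1 ≤ b s.2} {s : m × m // b s.1 ≤ b s.2} ℝ :=
    fun s t => if t.1.1 = s.1.1 then M.1 t.1.2 s.1.2 else 0
  have hconj : (blockEntries b).toLinearMap ∘ₗ LinearMap.mulRight ℝ M ∘ₗ
      (blockEntries b).symm.toLinearMap = toLin' N := by
    rw [← LinearMap.comp_assoc, LinearEquiv.comp_toLinearMap_symm_eq]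
    refine LinearMap.ext fun X => funext fun s => ?_
    change (X.1 * M.1) s.1.1 s.1.2 = ∑ t : {s : m × m // b s.1 ≤ b s.2},
      (if t.1.1 = s.1.1 then M.1 t.1.2 s.1.2 else 0) * X.1 t.1.1 t.1.2
    rw [sum_blockEntries b fun t => (if t.1 = s.1.1 then M.1 t.2 s.1.2 else 0) * X.1 t.1 t.2,
      mul_apply, Finset.sum_comm]
    refine Finset.sum_congr rfl fun i _ => ?_
    rw [Finset.sum_eq_single s.1.1 (fun j _ hj => by simp [hj]) (by simp)]
    by_cases h : b s.1.1 ≤ b i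
    · simp [h, mul_comm]
    · simp [h, X.2 (not_le.mp h)]
  rw [← LinearMap.det_conj _ (blockEntries b), hconj, LinearMap.det_toLin',
    BlockTriangular.det_fintype (b := fun s => s.1.1)
      (fun s t hst => by simp [N, hst.ne])]
  refine Finset.prod_congr rfl fun k _ => ?_
  let e : {i // b k ≤ b i} ≃ {s : {s : m × m // b s.1 ≤ b s.2} // s.1.1 = k} :=
    { toFun := fun i => ⟨⟨(k, i.1), i.2⟩, rfl⟩
      invFun := fun s => ⟨s.1.1.2, by have h := s.1.2; rwa [s.2] at h⟩
      left_inv := fun _ => rfl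
      right_inv := by rintro ⟨⟨⟨i, j⟩, h⟩, rfl⟩; rfl }
  rw [← det_submatrix_equiv_self e, ← det_transpose]
  congr 1
  ext i j
  exact if_pos rfl

omit [LinearOrder m] in
theorem det_toSquareBlockProp_congr [DecidableEq m] (M : Matrix m m ℝ) {p q : m → Prop}
    [DecidablePred p] [DecidablePred q] (h : ∀ i, p i ↔ q i) :
    (toSquareBlockProp M p).det = (toSquareBlockProp M q).det := by
  rw [← det_submatrix_equiv_self (Equiv.subtypeEquivRight h)]
  rfl

theorem det_eq_mul_of_blockTriangular (M : blockTriangularSubalgebra ℝ ℝ b) (c : ℕ) :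
    M.1.det = (toSquareBlockProp M.1 fun i => b i < c).det *
      (toSquareBlockProp M.1 fun i => c ≤ b i).det := by
  have h := twoBlockTriangular_det M.1 (fun i => b i < c)
    (fun i hi j hj => M.2 (lt_of_lt_of_le hj (not_lt.mp hi)))
  rw [h, det_toSquareBlockProp_congr M.1 (p := fun i => c ≤ b i) fun i => not_lt.symm]

end BlockTriangularDet

/-! ### Blocks of coordinates and the exponents of the functional -/

section Index

variable {n r : ℕ} (I : FlagIndex n r)

/-- The number of the block of a coordinate. -/
def FlagIndex.block (a : Fin n) : ℕ := (Finset.univ.filter fun j : Fin r => I.idx j ≤ a).card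

theorem FlagIndex.ext_succ_of_lt {k : ℕ} (hk : k < r) : I.ext (k + 1) = I.idx ⟨k, hk⟩ := by
  simp [FlagIndex.ext, hk]

theorem FlagIndex.ext_succ (j : Fin r) : I.ext (j + 1) = I.idx j := I.ext_succ_of_lt j.2

theorem FlagIndex.ext_zero : I.ext 0 = 0 := by simp [FlagIndex.ext]

theorem FlagIndex.ext_last : I.ext (r + 1) = n := by simp [FlagIndex.ext]

theorem FlagIndex.block_le (a : Fin n) : I.block a ≤ r := by
  simpa [FlagIndex.block] using Finset.card_filter_le (Finset.univ : Finset (Fin r))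
    (fun j => I.idx j ≤ a)

/-- The `j` counted by `block a` form an initial segment of `Fin r`. Coordinates are counted from
`0`, so block `k` consists of the `a` with `i_k ≤ a < i_{k+1}`. -/
theorem FlagIndex.block_le_iff {k : ℕ} (hk : k ≤ r) (a : Fin n) :
    I.block a ≤ k ↔ (a : ℕ) < I.ext (k + 1) := by
  rcases hk.lt_or_eq with hk | rfl
  · rw [I.ext_succ_of_lt hk]
    constructor
    · intro h
      by_contra! hc
      have : Finset.Iic (⟨k, hk⟩ : Fin r) ⊆ Finset.univ.filter fun j : Fin r => I.idx j ≤ a :=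
        fun j hj => by
          simpa using (I.strictMono.monotone (Finset.mem_Iic.mp hj)).trans hc
      have := Finset.card_le_card this
      rw [Fin.card_Iic] at this
      change k + 1 ≤ I.block a at this
      omega
    · intro h
      have : (Finset.univ.filter fun j : Fin r => I.idx j ≤ a) ⊆ Finset.Iio (⟨k, hk⟩ : Fin r) :=
        fun j hj => by
          rw [Finset.mem_Iio]
          by_contra! hc
          have h1 := I.strictMono.monotone hc
          have h2 := (Finset.mem_filter.mp hj).2
          omega
      have := Finset.card_le_card this
      rw [Fin.card_Iio] at this
      exact this
  · simp [I.ext_last, I.block_le a]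

theorem FlagIndex.block_lt_iff {k : ℕ} (hk : k ≤ r) (a : Fin n) :
    I.block a < k ↔ (a : ℕ) < I.ext k := by
  cases k with
  | zero => simp [I.ext_zero]
  | succ k => rw [Nat.lt_succ_iff, I.block_le_iff (by omega)]

theorem FlagIndex.ext_le (k : ℕ) : I.ext k ≤ n := by
  unfold FlagIndex.ext
  split_ifs with h h'
  · exact Nat.zero_le _
  · exact (I.lt _).le
  · exact le_rfl

theorem FlagIndex.ext_mono : Monotone I.ext := by
  refine monotone_nat_of_le_succ fun k => ?_
  cases k with
  | zero => simp [I.ext_zero]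
  | succ k =>
    by_cases h : k + 1 < r
    · rw [I.ext_succ_of_lt h, I.ext_succ_of_lt (by omega : k < r)]
      exact I.strictMono.monotone (by simp)
    · have : I.ext (k + 1 + 1) = n := by simp [FlagIndex.ext, h]
      rw [this]
      exact I.ext_le _

theorem FlagIndex.card_block_eq {k : ℕ} (hk : k ≤ r) :
    (Finset.univ.filter fun a : Fin n => I.block a = k).card = I.ext (k + 1) - I.ext k := by
  have h1 : (Finset.univ.filter fun a : Fin n => I.block a = k) =
      (Finset.univ.filter fun a : Fin n => (a : ℕ) < I.ext (k + 1)) \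
        (Finset.univ.filter fun a : Fin n => (a : ℕ) < I.ext k) := by
    ext a
    simp only [Finset.mem_filter, Finset.mem_univ, true_and, Finset.mem_sdiff,
      ← I.block_le_iff hk, ← I.block_lt_iff hk]
    omega
  rw [h1, Finset.card_sdiff_of_subset, Fin.card_filter_val_lt, Fin.card_filter_val_lt,
    min_eq_right (I.ext_le _), min_eq_right (I.ext_le _)]
  intro a ha
  simp only [Finset.mem_filter, Finset.mem_univ, true_and] at ha ⊢
  exact ha.trans_le (I.ext_mono k.le_succ)

theorem FlagIndex.prod_block (D : ℕ → ℝ) :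
    ∏ a, D (I.block a) = ∏ k ∈ Finset.range (r + 1), D k ^ (I.ext (k + 1) - I.ext k) := by
  rw [← Finset.prod_fiberwise_of_maps_to (g := I.block) (t := Finset.range (r + 1))
    (fun a _ => by simpa [Nat.lt_succ_iff] using I.block_le a)]
  refine Finset.prod_congr rfl fun k hk => ?_
  rw [Finset.prod_congr rfl (g := fun _ => D k) (fun a ha => by rw [(Finset.mem_filter.mp ha).2]),
    Finset.prod_const, I.card_block_eq (by simpa [Nat.lt_succ_iff] using hk)]

/-- The exponents of the flag quermassintegral combine with the block sizes. -/
theorem FlagIndex.prod_block_mul_prod_block {D : ℕ → ℝ} (hD : ∀ k, 0 < D k) (h0 : D 0 = 1) :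
    (∏ a, D (I.block a + 1)) * ∏ a, D (I.block a) =
      D (r + 1) ^ ((n : ℝ) - I.ext r) *
        ∏ j : Fin r, (D (j + 1) ^ ((I.ext j : ℝ) - I.ext (j + 2)))⁻¹ := by
  -- Splits off the last block of the first product, which gives the power of `D (r + 1)`, and the
  -- first block of the second, which is trivial by `h0`. Then `D (j + 1)` collects `(i_{j+1} - i_j)
  -- + (i_{j+2} - i_{j+1}) = i_{j+2} - i_j`.
  rw [I.prod_block fun k => D (k + 1), I.prod_block D, Finset.prod_range_succ,
    Finset.prod_range_succ' (fun k => D k ^ _), h0, one_pow, mul_one, I.ext_last]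
  have h1 : (D (r + 1) ^ (n - I.ext r) : ℝ) = D (r + 1) ^ ((n : ℝ) - I.ext r) := by
    rw [← Nat.cast_sub (I.ext_le r), Real.rpow_natCast]
  rw [h1, mul_right_comm, mul_comm, ← Finset.prod_mul_distrib, ← Fin.prod_univ_eq_prod_range
    (fun k => D (k + 1) ^ (I.ext (k + 1) - I.ext k) *
      D (k + 1) ^ (I.ext (k + 1 + 1) - I.ext (k + 1))) r]
  congr 1
  refine Finset.prod_congr rfl fun j _ => ?_
  rw [← Real.rpow_neg (hD _).le, ← pow_add, ← Real.rpow_natCast, Nat.cast_add,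
    Nat.cast_sub (I.ext_mono (Nat.le_succ _)), Nat.cast_sub (I.ext_mono (Nat.le_succ _))]
  congr 1
  ring

end Index

end

section

/-! ### Volume distortion on subspaces -/

section NormDet

open Module

/-- Sylvester's identity without coordinates. It moves a Gram determinant from a varying subspace to
the fixed space `ℝⁿ`. -/
theorem det_one_add_comp_comm {V W : Type*} [AddCommGroup V] [Module ℝ V]
    [FiniteDimensional ℝ V] [AddCommGroup W] [Module ℝ W] [FiniteDimensional ℝ W]
    (f : V →ₗ[ℝ] W) (g : W →ₗ[ℝ] V) :
    LinearMap.det (1 + f ∘ₗ g) = LinearMap.det (1 + g ∘ₗ f) := by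
  let v := finBasis ℝ V
  let w := finBasis ℝ W
  rw [← LinearMap.det_toMatrix w, ← LinearMap.det_toMatrix v, map_add, map_add,
    LinearMap.toMatrix_one, LinearMap.toMatrix_one, LinearMap.toMatrix_comp w v w,
    LinearMap.toMatrix_comp v w v, Matrix.det_one_add_mul_comm]

theorem normDet_adjoint_of_finrank_eq {V W : Type*} [NormedAddCommGroup V]
    [InnerProductSpace ℝ V] [FiniteDimensional ℝ V] [NormedAddCommGroup W]
    [InnerProductSpace ℝ W] [FiniteDimensional ℝ W] (f : V →ₗ[ℝ] W)
    (h : finrank ℝ V = finrank ℝ W) : f.adjoint.normDet = f.normDet := by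
  let v := (stdOrthonormalBasis ℝ V).reindex (finCongr h)
  let w := stdOrthonormalBasis ℝ W
  rw [f.normDet_eq_norm_det_toMatrix v w, f.adjoint.normDet_eq_norm_det_toMatrix w v,
    LinearMap.toMatrix_adjoint v w, Matrix.det_conjTranspose, norm_star]

end NormDet

/-- The algebra of endomorphisms of a Euclidean space. -/
abbrev EndOf (V : Type*) [NormedAddCommGroup V] [InnerProductSpace ℝ V] := V →L[ℝ] V

instance {V : Type*} [NormedAddCommGroup V] [InnerProductSpace ℝ V] [FiniteDimensional ℝ V]
    (S : Subalgebra ℝ (EndOf V)) : CompleteSpace S := FiniteDimensional.complete ℝ _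

/-- The algebra of endomorphisms of `ℝⁿ`. -/
abbrev End (n : ℕ) : Type := EndOf (E n)

variable {n r : ℕ}

section Jacobian

open Module

/-- The factor by which `u` changes volumes in the subspace `F`. -/
def jac (F : Submodule ℝ (E n)) (u : End n) : ℝ := (u.toLinearMap.domRestrict F).normDet

theorem units_injective (u : (End n)ˣ) : Function.Injective (u : End n) :=
  (ContinuousLinearEquiv.unitsEquiv ℝ (E n) u).injective

theorem jac_pos (F : Submodule ℝ (E n)) (u : (End n)ˣ) : 0 < jac F u := by
  refine lt_of_le_of_ne (LinearMap.normDet_nonneg _) (Ne.symm ?_)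
  refine ((LinearMap.normDet_ne_zero_tfae _).out 0 4).mpr fun x y hxy => ?_
  exact Subtype.ext (units_injective u hxy)

theorem jac_mul (F : Submodule ℝ (E n)) (u v : End n) :
    jac F (u * v) = jac (F.map v.toLinearMap) u * jac F v := by
  have h := LinearMap.normDet_comp (v.toLinearMap.domRestrict F) u.toLinearMap
  have h2 : jac (v.toLinearMap.domRestrict F).range u = jac (F.map v.toLinearMap) u := by
    rw [LinearMap.range_domRestrict]
  rw [← h2]
  exact h

/-- The operator whose determinant is the square of the Jacobian. -/
def gramOp (F : Submodule ℝ (E n)) (u : End n) : End n :=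
  1 + (ContinuousLinearMap.adjoint u * u - 1) * F.starProjection

/-- The Gram operator of `u` on `F` is `1 + P_F (u* u - 1)` restricted to `F`; Sylvester's identity
turns its determinant into one on `ℝⁿ`. This makes `jac` visibly continuous in `u` and in the
projection onto `F`. -/
theorem jac_sq (F : Submodule ℝ (E n)) (u : End n) :
    jac F u ^ 2 = (gramOp F u).det := by
  have h := (u ∘L F.subtypeL).normDet_sq
  have h0 : (u ∘L F.subtypeL).toLinearMap.normDet = jac F u := rfl
  rw [h0] at h
  refine h.trans ?_
  have h1 : ContinuousLinearMap.adjoint (u ∘L F.subtypeL) ∘L (u ∘L F.subtypeL) =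
      1 + F.orthogonalProjectionOnto ∘L
        ((ContinuousLinearMap.adjoint u * u - 1) ∘L F.subtypeL) := by
    rw [ContinuousLinearMap.adjoint_comp, Submodule.adjoint_subtypeL]
    ext x
    simp
  rw [h1]
  exact det_one_add_comp_comm F.orthogonalProjectionOnto.toLinearMap
    ((ContinuousLinearMap.adjoint u * u - 1) ∘L F.subtypeL).toLinearMap

theorem jac_eq_sqrt (F : Submodule ℝ (E n)) (u : End n) :
    jac F u = √(gramOp F u).det := by
  have h : 0 ≤ jac F u := LinearMap.normDet_nonneg _
  rw [← jac_sq, Real.sqrt_sq h]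

theorem isUnit_gramOp (F : Submodule ℝ (E n)) (u : (End n)ˣ) : IsUnit (gramOp F u) := by
  have h : (gramOp F (u : End n)).det ≠ 0 := by
    rw [← jac_sq]
    exact pow_ne_zero 2 (jac_pos F u).ne'
  exact ⟨(ContinuousLinearEquiv.unitsEquiv ℝ (E n)).symm
    ((gramOp F (u : End n)).toContinuousLinearEquivOfDetNeZero h), by ext; rfl⟩

/-- If `gramOp F u` sends `z` to `u* x`, then `u* (x - u P_F z) = z - P_F z` is orthogonal to `F`,
so `x - u P_F z` is orthogonal to `uF`. The explicit formula serves the continuity of the action on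
flags. -/
theorem starProjection_map_units (F : Submodule ℝ (E n)) (u : (End n)ˣ) :
    (F.map (u : End n).toLinearMap).starProjection =
      (u : End n) * F.starProjection * Ring.inverse (gramOp F u) *
        ContinuousLinearMap.adjoint (u : End n) := by
  obtain ⟨a, ha⟩ := isUnit_gramOp F u
  rw [← ha, Ring.inverse_unit]
  ext1 x
  have hmem : ((u : End n) * F.starProjection * ((a⁻¹ : (End n)ˣ) : End n) *
      ContinuousLinearMap.adjoint (u : End n)) x ∈ F.map (u : End n).toLinearMap :=
    Submodule.mem_map.mpr ⟨_, F.starProjection_apply_mem _, rfl⟩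
  refine Submodule.eq_starProjection_of_mem_of_inner_eq_zero hmem ?_
  rintro _ ⟨y, hy, rfl⟩
  have hy' : F.starProjection y = y := Submodule.starProjection_eq_self_iff.mpr hy
  set w := ContinuousLinearMap.adjoint (u : End n) x with hw
  set z := ((a⁻¹ : (End n)ˣ) : End n) w with hz
  have haz : (a : End n) z = w := by
    change ((a : End n) * ((a⁻¹ : (End n)ˣ) : End n)) w = w
    rw [Units.mul_inv]
    rfl
  have haz' : z + (ContinuousLinearMap.adjoint (u : End n) ((u : End n) (F.starProjection z)) -
      F.starProjection z) = w := by
    rw [← haz, ha]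
    rfl
  change inner ℝ (x - (u : End n) (F.starProjection z)) ((u : End n) y) = 0
  rw [← ContinuousLinearMap.adjoint_inner_left, map_sub, ← hw, ← haz']
  have h1 : z + (ContinuousLinearMap.adjoint (u : End n) ((u : End n) (F.starProjection z)) -
      F.starProjection z) -
      ContinuousLinearMap.adjoint (u : End n) ((u : End n) (F.starProjection z)) =
      z - F.starProjection z := by abel
  rw [h1]
  exact F.starProjection_inner_eq_zero z y hy

theorem jac_of_isometry (F : Submodule ℝ (E n)) (e : E n ≃ₗᵢ[ℝ] E n) (u : End n)
    (h : ∀ x, u x = e x) : jac F u = 1 := by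
  have h1 : u.toLinearMap.domRestrict F =
      (e.toLinearIsometry.comp F.subtypeₗᵢ).toLinearMap := by
    ext1 x
    exact h x
  rw [jac, h1, LinearIsometry.normDet_eq_one]

/-- Projections of the image under an adjoint. -/
theorem projVol_adjoint_image (F : Submodule ℝ (E n)) (u : (End n)ˣ) (L : Set (E n)) :
    projVol F (ContinuousLinearMap.adjoint (u : End n) '' L) =
      ENNReal.ofReal (jac F u) * projVol (F.map (u : End n).toLinearMap) L := by
  set W := F.map (u : End n).toLinearMap with hW
  let v : F →ₗ[ℝ] W := ((u : End n).toLinearMap.domRestrict F).codRestrict W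
    fun x => ⟨x, x.2, rfl⟩
  have hfin : finrank ℝ F = finrank ℝ W :=
    (LinearEquiv.finrank_map_eq
      (ContinuousLinearEquiv.unitsEquiv ℝ (E n) u).toLinearEquiv F).symm
  have hv : v.adjoint.normDet = jac F u := by
    rw [normDet_adjoint_of_finrank_eq _ hfin]
    exact LinearMap.normDet_codRestrict _
  -- Both sides have inner product `⟪u y, x⟫` with every `y` in `F`.
  have hproj : ∀ x, F.orthogonalProjectionOnto (ContinuousLinearMap.adjoint (u : End n) x) =
      v.adjoint (W.orthogonalProjectionOnto x) := by
    intro x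
    refine ext_inner_left ℝ fun y => ?_
    rw [LinearMap.adjoint_inner_right, Submodule.inner_orthogonalProjectionOnto_eq_of_mem_left,
      ContinuousLinearMap.adjoint_inner_right,
      Submodule.inner_orthogonalProjectionOnto_eq_of_mem_left]
    rfl
  have himg : F.orthogonalProjectionOnto '' (ContinuousLinearMap.adjoint (u : End n) '' L) =
      v.adjoint '' (W.orthogonalProjectionOnto '' L) := by
    rw [Set.image_image, Set.image_image]
    exact Set.image_congr fun x _ => hproj x
  -- The area formula for linear maps holds for arbitrary sets, so `L` need not be measurable.
  rw [projVol, himg, ← hv, projVol, ← LinearMap.euclideanHausdorffMeasure_image_eq_normDet_mul_volume,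
    ← hfin, InnerProductSpace.euclideanHausdorffMeasure_eq_volume]

end Jacobian

/-! ### The continuous action of `GL_n` on flags -/

section Action

variable {I : FlagIndex n r}

instance : SMul (End n)ˣ (Flag I) where
  smul u ξ :=
    { space := fun j => (ξ.space j).map (u : End n).toLinearMap
      finrank_eq := fun j =>
        (LinearEquiv.finrank_map_eq (ContinuousLinearEquiv.unitsEquiv ℝ (E n) u).toLinearEquiv
          (ξ.space j)).trans (ξ.finrank_eq j)
      mono := fun _ _ h => Submodule.map_mono (ξ.mono h) }

theorem units_smul_space (u : (End n)ˣ) (ξ : Flag I) (j : Fin r) :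
    (u • ξ).space j = (ξ.space j).map (u : End n).toLinearMap := rfl

instance : MulAction (End n)ˣ (Flag I) where
  one_smul ξ := by
    ext1
    funext j
    exact Submodule.map_id _
  mul_smul u v ξ := by
    ext1
    funext j
    exact Submodule.map_comp _ _ _

theorem continuous_flag_starProjection (j : Fin r) :
    Continuous fun ξ : Flag I => ((ξ.space j).starProjection : End n) :=
  (continuous_apply (A := fun _ : Fin r => End n) j).comp
    (continuous_induced_dom (f := fun (ξ : Flag I) (j : Fin r) =>
      ((ξ.space j).starProjection : End n)))

theorem continuous_gramOp (j : Fin r) :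
    Continuous fun p : (End n)ˣ × Flag I => gramOp (p.2.space j) p.1 := by
  have h1 := (continuous_flag_starProjection (I := I) j).comp
    (continuous_snd (X := (End n)ˣ))
  have h2 : Continuous fun p : (End n)ˣ × Flag I => ((p.1 : (End n)ˣ) : End n) :=
    Units.continuous_val.comp continuous_fst
  have h3 : Continuous fun p : (End n)ˣ × Flag I =>
      ContinuousLinearMap.adjoint (p.1 : End n) :=
    (ContinuousLinearMap.adjoint (𝕜 := ℝ) (E := E n) (F := E n)).continuous.comp h2
  exact continuous_const.add (((h3.mul h2).sub continuous_const).mul h1)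

theorem continuous_jac (j : Fin r) :
    Continuous fun p : (End n)ˣ × Flag I => jac (p.2.space j) p.1 := by
  simp only [jac_eq_sqrt]
  exact (ContinuousLinearMap.continuous_det.comp (continuous_gramOp j)).sqrt

theorem continuous_units_smul : Continuous fun p : (End n)ˣ × Flag I => p.1 • p.2 := by
  refine continuous_induced_rng.mpr (continuous_pi fun j => ?_)
  simp only [Function.comp_def, units_smul_space, starProjection_map_units]
  have h1 := (continuous_flag_starProjection (I := I) j).comp
    (continuous_snd (X := (End n)ˣ))
  have h2 : Continuous fun p : (End n)ˣ × Flag I => ((p.1 : (End n)ˣ) : End n) :=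
    Units.continuous_val.comp continuous_fst
  have h3 : Continuous fun p : (End n)ˣ × Flag I =>
      ContinuousLinearMap.adjoint (p.1 : End n) :=
    (ContinuousLinearMap.adjoint (𝕜 := ℝ) (E := E n) (F := E n)).continuous.comp h2
  have h4 : Continuous fun p : (End n)ˣ × Flag I => Ring.inverse (gramOp (p.2.space j) p.1) := by
    refine continuous_iff_continuousAt.mpr fun p => ?_
    obtain ⟨a, ha⟩ := isUnit_gramOp (p.2.space j) p.1
    have h5 : ContinuousAt Ring.inverse (gramOp (p.2.space j) p.1) :=
      ha ▸ NormedRing.inverse_continuousAt a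
    exact ContinuousAt.comp (f := fun p : (End n)ˣ × Flag I => gramOp (p.2.space j) p.1) h5
      (continuous_gramOp j).continuousAt
  exact ((h2.mul h1).mul h4).mul h3

instance : ContinuousSMul (End n)ˣ (Flag I) := ⟨continuous_units_smul⟩

/-- Rotations as units of the algebra of endomorphisms. -/
def rotUnit : SO n →* (End n)ˣ :=
  MonoidHom.toHomUnits
    ((Matrix.toEuclideanCLM (n := Fin n) (𝕜 := ℝ) : Matrix (Fin n) (Fin n) ℝ →* End n).comp
      (Matrix.specialOrthogonalGroup (Fin n) ℝ).subtype)

theorem rotUnit_apply (g : SO n) (x : E n) : (rotUnit g : End n) x = rot g x := rfl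

theorem rotUnit_smul (g : SO n) (ξ : Flag I) : rotUnit g • ξ = g • ξ := rfl

theorem jac_rotUnit (F : Submodule ℝ (E n)) (g : SO n) : jac F (rotUnit g) = 1 :=
  jac_of_isometry F (rot g) _ (rotUnit_apply g)

end Action

end

section

open Module Matrix

variable {n r : ℕ}

/-- The matrix of an endomorphism of `ℝⁿ`. -/
def mat : End n ≃ₐ[ℝ] Matrix (Fin n) (Fin n) ℝ :=
  (Matrix.toEuclideanCLM (n := Fin n) (𝕜 := ℝ)).symm.toAlgEquiv

theorem apply_eq_mat_mulVec (u : End n) (x : E n) (a : Fin n) : u x a = ∑ b, mat u a b * x b := by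
  conv_lhs => rw [← mat.symm_apply_apply u]
  rfl

theorem mat_apply (u : End n) (a b : Fin n) : mat u a b = u (EuclideanSpace.single b 1) a := by
  rw [apply_eq_mat_mulVec]
  simp [PiLp.single_apply]

theorem det_mat (u : End n) : (mat u).det = u.det := by
  have h : u = Matrix.toEuclideanCLM (n := Fin n) (𝕜 := ℝ) (mat u) :=
    (mat.symm_apply_apply u).symm
  conv_rhs => rw [h]
  rw [ContinuousLinearMap.det, coe_toEuclideanCLM_eq_toEuclideanLin]
  simp [toLpLin_eq_toLin]

theorem det_adjoint (u : End n) : (ContinuousLinearMap.adjoint u).det = u.det := by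
  have h1 : mat (ContinuousLinearMap.adjoint u) = (mat u).conjTranspose :=
    (Matrix.toEuclideanCLM (n := Fin n) (𝕜 := ℝ)).symm.map_star' u
  rw [← det_mat, h1, Matrix.det_conjTranspose, det_mat, star_trivial]

/-! ### The coordinate subspaces of the standard flag -/

section CoordSpace

/-- The span of the first `m` vectors of the standard basis. -/
def coordSpace (n m : ℕ) : Submodule ℝ (E n) where
  carrier := {x | ∀ a : Fin n, m ≤ a → x a = 0}
  add_mem' hx hy a ha := by simp [hx a ha, hy a ha]
  zero_mem' a _ := by simp
  smul_mem' c x hx a ha := by simp [hx a ha]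

/-- The coordinates in `coordSpace n m`. -/
def coordSpaceEquiv (n m : ℕ) : coordSpace n m ≃ₗ[ℝ] ({a : Fin n // (a : ℕ) < m} → ℝ) where
  toFun x a := x.1 a.1
  map_add' _ _ := rfl
  map_smul' _ _ := rfl
  invFun y := ⟨WithLp.toLp 2 fun a => if h : (a : ℕ) < m then y ⟨a, h⟩ else 0, fun a ha => by
    simp [not_lt.mpr ha]⟩
  left_inv x := by
    ext a
    by_cases h : (a : ℕ) < m
    · simp [h]
    · simpa [h] using (x.2 a (not_lt.mp h)).symm
  right_inv y := by
    ext a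
    simp [a.2]

theorem finrank_coordSpace {m : ℕ} (hm : m ≤ n) : finrank ℝ (coordSpace n m) = m := by
  rw [(coordSpaceEquiv n m).finrank_eq, finrank_fintype_fun_eq_card, Fintype.card_subtype,
    Fin.card_filter_val_lt, min_eq_right hm]

theorem coordSpace_eq_top : coordSpace n n = ⊤ :=
  eq_top_iff.mpr fun _ _ a ha => absurd a.2 (not_lt.mpr ha)

theorem stdFlag_space (I : FlagIndex n r) (j : Fin r) :
    (stdFlag I).space j = coordSpace n (I.ext (j + 1)) := by
  rw [I.ext_succ]
  refine Submodule.eq_of_le_of_finrank_eq ?_ ?_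
  · refine Submodule.span_le.mpr ?_
    rintro _ ⟨k, rfl⟩ a ha
    have h : a ≠ Fin.castLE (I.lt j).le k := by
      rintro rfl
      exact absurd k.2 (not_lt.mpr ha)
    simp [h]
  · rw [(stdFlag I).finrank_eq, finrank_coordSpace (I.lt j).le]

/-- The hypothesis says that `u` preserves the subspace, so `jac` is the absolute determinant of the
restriction, whose matrix is the upper left block. -/
theorem jac_coordSpace {m : ℕ} {u : End n}
    (hu : ∀ a b : Fin n, m ≤ a → (b : ℕ) < m → mat u a b = 0) :
    jac (coordSpace n m) u = |(toSquareBlockProp (mat u) fun a => (a : ℕ) < m).det| := by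
  have hmem : ∀ x : coordSpace n m, u.toLinearMap.domRestrict _ x ∈ coordSpace n m := by
    intro x a ha
    change u x.1 a = 0
    rw [apply_eq_mat_mulVec]
    refine Finset.sum_eq_zero fun b _ => ?_
    by_cases h : (b : ℕ) < m
    · rw [hu a b ha h, zero_mul]
    · rw [x.2 b (not_lt.mp h), mul_zero]
  let v : coordSpace n m →ₗ[ℝ] coordSpace n m :=
    (u.toLinearMap.domRestrict _).codRestrict _ hmem
  have hv : v.normDet = jac (coordSpace n m) u := LinearMap.normDet_codRestrict _
  have hconj : (coordSpaceEquiv n m).toLinearMap ∘ₗ v ∘ₗ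
      (coordSpaceEquiv n m).symm.toLinearMap =
      toLin' (toSquareBlockProp (mat u) fun a => (a : ℕ) < m) := by
    rw [← LinearMap.comp_assoc, LinearEquiv.comp_toLinearMap_symm_eq]
    refine LinearMap.ext fun x => funext fun a => ?_
    change u x.1 a.1 = ∑ b : {a : Fin n // (a : ℕ) < m}, mat u a.1 b.1 * x.1 b.1
    rw [apply_eq_mat_mulVec, ← Finset.sum_subtype (Finset.univ.filter fun a : Fin n => (a : ℕ) < m)
      (by simp) (fun b => mat u a.1 b * x.1 b), Finset.sum_filter]
    refine Finset.sum_congr rfl fun b _ => ?_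
    by_cases h : (b : ℕ) < m
    · simp [h]
    · simp [h, x.2 b (not_lt.mp h)]
  rw [← hv, LinearMap.normDet_eq_abs_det, ← LinearMap.det_conj _ (coordSpaceEquiv n m), hconj,
    LinearMap.det_toLin']

theorem jac_coordSpace_top (u : End n) : jac (coordSpace n n) u = |u.det| := by
  rw [jac_eq_sqrt, coordSpace_eq_top, gramOp, Submodule.starProjection_top', mul_one,
    add_sub_cancel, ← Real.sqrt_sq_eq_abs, sq]
  congr 1
  rw [← det_mat, map_mul, det_mul, det_mat, det_mat, det_adjoint]

end CoordSpace

/-! ### The stabiliser of the standard flag and its modulus -/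

section Parabolic

variable (I : FlagIndex n r)

/-- The algebra of endomorphisms which preserve the standard flag. -/
def parabolic : Subalgebra ℝ (End n) :=
  (blockTriangularSubalgebra ℝ ℝ I.block).comap mat.toAlgHom

/-- Endomorphisms which preserve the standard flag as block triangular matrices. -/
def parabolicEquiv : parabolic I ≃ₗ[ℝ] blockTriangularSubalgebra ℝ ℝ I.block where
  toFun p := ⟨mat p.1, p.2⟩
  map_add' p q := Subtype.ext (map_add mat p.1 q.1)
  map_smul' c p := Subtype.ext (map_smul mat c p.1)
  invFun M := ⟨mat.symm M.1, by
    change mat (mat.symm M.1) ∈ blockTriangularSubalgebra ℝ ℝ I.block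
    rw [AlgEquiv.apply_symm_apply]
    exact M.2⟩
  left_inv p := Subtype.ext (mat.symm_apply_apply p.1)
  right_inv M := Subtype.ext (mat.apply_symm_apply M.1)

variable {I}

theorem mat_eq_zero_of_parabolic {k : ℕ} (hk : k ≤ r + 1) (p : parabolic I) {a b : Fin n}
    (ha : I.ext k ≤ a) (hb : (b : ℕ) < I.ext k) : mat p.1 a b = 0 := by
  rcases hk.lt_or_eq with hk | rfl
  · refine p.2 ?_
    have h1 := (I.block_lt_iff (Nat.lt_succ_iff.mp hk) b).mpr hb
    have h2 := (I.block_lt_iff (Nat.lt_succ_iff.mp hk) a).not.mpr (not_lt.mpr ha)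
    omega
  · rw [I.ext_last] at ha
    exact absurd a.2 (not_lt.mpr ha)

theorem jac_parabolic {k : ℕ} (hk : k ≤ r + 1) (p : parabolic I) :
    jac (coordSpace n (I.ext k)) p.1 =
      |(toSquareBlockProp (mat p.1) fun a => (a : ℕ) < I.ext k).det| :=
  jac_coordSpace fun _ _ => mat_eq_zero_of_parabolic hk p

/-- The inclusion of the units of the parabolic algebra. -/
def parabolicUnit : (parabolic I)ˣ →* (End n)ˣ := Units.map ((parabolic I).val : _ →* End n)

theorem coe_parabolicUnit (p : (parabolic I)ˣ) : (parabolicUnit p : End n) = p.1.1 := rfl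

theorem continuous_parabolicUnit : Continuous (parabolicUnit : (parabolic I)ˣ → (End n)ˣ) :=
  Continuous.units_map _ continuous_subtype_val

theorem map_coordSpace_parabolicUnit {k : ℕ} (hk : k ≤ r + 1) (p : (parabolic I)ˣ) :
    (coordSpace n (I.ext k)).map (parabolicUnit p : End n).toLinearMap =
      coordSpace n (I.ext k) := by
  refine Submodule.eq_of_le_of_finrank_eq ?_ ?_
  · rintro _ ⟨x, hx, rfl⟩ a ha
    change p.1.1 x a = 0
    rw [apply_eq_mat_mulVec]
    refine Finset.sum_eq_zero fun b _ => ?_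
    by_cases h : (b : ℕ) < I.ext k
    · rw [mat_eq_zero_of_parabolic hk p.1 ha h, zero_mul]
    · rw [hx b (not_lt.mp h), mul_zero]
  · exact LinearEquiv.finrank_map_eq
      (ContinuousLinearEquiv.unitsEquiv ℝ (E n) (parabolicUnit p)).toLinearEquiv _

theorem parabolicUnit_smul_stdFlag (p : (parabolic I)ˣ) :
    parabolicUnit p • stdFlag I = stdFlag I := by
  ext1
  funext j
  rw [units_smul_space, stdFlag_space, map_coordSpace_parabolicUnit (by omega)]

theorem jac_mul_parabolicUnit {k : ℕ} (hk : k ≤ r + 1) (u : End n) (p : (parabolic I)ˣ) :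
    jac (coordSpace n (I.ext k)) (u * parabolicUnit p) =
      jac (coordSpace n (I.ext k)) u * jac (coordSpace n (I.ext k)) (parabolicUnit p) := by
  rw [jac_mul, map_coordSpace_parabolicUnit hk]

theorem abs_det_mulLeft_parabolic (p : parabolic I) :
    |LinearMap.det (LinearMap.mulLeft ℝ p)| =
      ∏ a, jac (coordSpace n (I.ext (I.block a + 1))) p.1 := by
  have h : (parabolicEquiv I).toLinearMap ∘ₗ LinearMap.mulLeft ℝ p ∘ₗ
      (parabolicEquiv I).symm.toLinearMap = LinearMap.mulLeft ℝ (parabolicEquiv I p) := by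
    rw [← LinearMap.comp_assoc, LinearEquiv.comp_toLinearMap_symm_eq]
    exact LinearMap.ext fun q => Subtype.ext (map_mul mat p.1 q.1)
  rw [← LinearMap.det_conj _ (parabolicEquiv I), h, det_mulLeft_blockTriangular,
    Finset.abs_prod]
  refine Finset.prod_congr rfl fun a _ => ?_
  rw [jac_parabolic (by have := I.block_le a; omega)]
  congr 1
  exact det_toSquareBlockProp_congr _ fun c => I.block_le_iff (I.block_le a) c

/-- Right multiplication produces the lower right corners of the matrix. Each is complementary to
the upper left corner below the block of `a`, and the two determinants multiply to the full one. -/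
theorem abs_det_mulRight_parabolic (p : parabolic I) :
    |LinearMap.det (LinearMap.mulRight ℝ p)| *
      ∏ a, jac (coordSpace n (I.ext (I.block a))) p.1 =
      jac (coordSpace n (I.ext (r + 1))) p.1 ^ n := by
  have h : (parabolicEquiv I).toLinearMap ∘ₗ LinearMap.mulRight ℝ p ∘ₗ
      (parabolicEquiv I).symm.toLinearMap = LinearMap.mulRight ℝ (parabolicEquiv I p) := by
    rw [← LinearMap.comp_assoc, LinearEquiv.comp_toLinearMap_symm_eq]
    exact LinearMap.ext fun q => Subtype.ext (map_mul mat q.1 p.1)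
  rw [← LinearMap.det_conj _ (parabolicEquiv I), h, det_mulRight_blockTriangular,
    Finset.abs_prod, ← Finset.prod_mul_distrib]
  rw [Finset.prod_congr rfl (g := fun _ => jac (coordSpace n (I.ext (r + 1))) p.1),
    Finset.prod_const, Finset.card_univ, Fintype.card_fin]
  intro a _
  rw [jac_parabolic (by have := I.block_le a; omega), ← abs_mul, mul_comm, I.ext_last,
    jac_coordSpace_top, ← det_mat]
  have h2 := det_eq_mul_of_blockTriangular I.block (parabolicEquiv I p) (I.block a)
  rw [← det_toSquareBlockProp_congr _ fun c => I.block_lt_iff (I.block_le a) c]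
  exact congrArg abs h2.symm

/-- The weight whose behaviour under translations from the right compensates for the modulus of
the parabolic group. -/
def flagWeight (I : FlagIndex n r) (u : End n) : ℝ :=
  (∏ j : Fin r, jac (coordSpace n (I.ext (j + 1))) u ^ ((I.ext j : ℝ) - I.ext (j + 2))) *
    jac (coordSpace n (I.ext (r + 1))) u ^ (I.ext r : ℝ)

theorem flagWeight_pos (u : (End n)ˣ) : 0 < flagWeight I u :=
  mul_pos (Finset.prod_pos fun _ _ => Real.rpow_pos_of_pos (jac_pos _ u) _)
    (Real.rpow_pos_of_pos (jac_pos _ u) _)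

/-- Chain rule: `p` maps each coordinate subspace of the flag to itself, so every Jacobian in the
weight is multiplicative. -/
theorem flagWeight_mul_parabolicUnit (u : (End n)ˣ) (p : (parabolic I)ˣ) :
    flagWeight I (u * parabolicUnit p : End n) = flagWeight I u * flagWeight I (parabolicUnit p) := by
  have h : ∀ k ≤ r + 1, ∀ e : ℝ, jac (coordSpace n (I.ext k)) (u * parabolicUnit p : End n) ^ e =
      jac (coordSpace n (I.ext k)) u ^ e * jac (coordSpace n (I.ext k)) (parabolicUnit p) ^ e := by
    intro k hk e
    rw [jac_mul_parabolicUnit hk, Real.mul_rpow (jac_pos _ u).le (jac_pos _ (parabolicUnit p)).le]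
  rw [flagWeight, h _ le_rfl, Finset.prod_congr rfl fun j _ => h _ (by omega) _,
    Finset.prod_mul_distrib, flagWeight, flagWeight]
  ring

/-- The modulus is `|det L_p| / |det R_p|` for left and right multiplication by `p`. Both are
products of Jacobians `D_k` on the coordinate subspaces, and `prod_block_mul_prod_block` collects
the exponents; the power `n - i_r` of `D_{r+1}`, divided by `D_{r+1} ^ n`, leaves `-i_r`. -/
theorem unitsModulus_parabolic (p : (parabolic I)ˣ) :
    unitsModulus p = ENNReal.ofReal (flagWeight I (parabolicUnit p))⁻¹ := by
  have hL := abs_det_mulLeft_parabolic p.1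
  have hR := abs_det_mulRight_parabolic p.1
  have hdens : unitsDensity p⁻¹ =
      ENNReal.ofReal |LinearMap.det (LinearMap.mulLeft ℝ (p : parabolic I))| := by
    have h1 : (unitsDensity p)⁻¹ = unitsDensity p⁻¹ :=
      (ENNReal.eq_inv_of_mul_eq_one_left (unitsDensity_inv_mul p)).symm
    rw [← h1, unitsDensity, abs_inv, ENNReal.ofReal_inv_of_pos
      (abs_pos.mpr (det_mulLeft_units_ne_zero p)), inv_inv]
  rw [unitsModulus, hdens, ← ENNReal.ofReal_mul (abs_nonneg _)]
  congr 1
  have hpos : ∀ k, 0 < jac (coordSpace n (I.ext k)) p.1.1 := fun k => jac_pos _ (parabolicUnit p)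
  have h0 : jac (coordSpace n (I.ext 0)) p.1.1 = 1 := by
    rw [jac_parabolic (Nat.zero_le _), I.ext_zero]
    have : IsEmpty {a : Fin n // (a : ℕ) < 0} := ⟨fun a => absurd a.2 (Nat.not_lt_zero _)⟩
    rw [det_isEmpty, abs_one]
  have hcomb := I.prod_block_mul_prod_block hpos h0
  have hR0 : 0 < |LinearMap.det (LinearMap.mulRight ℝ (p : parabolic I))| :=
    abs_pos.mpr (det_mulRight_units_ne_zero p)
  have hB : 0 < ∏ a, jac (coordSpace n (I.ext (I.block a))) p.1.1 :=
    Finset.prod_pos fun a _ => hpos _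
  rw [abs_inv, ← div_eq_mul_inv, ← mul_div_mul_right _ _ hB.ne', hL, hR, hcomb, flagWeight,
    Real.rpow_sub (hpos _), Real.rpow_natCast, Finset.prod_inv_distrib, coe_parabolicUnit]
  have hn : jac (coordSpace n (I.ext (r + 1))) p.1.1 ^ n ≠ 0 := (pow_pos (hpos _) _).ne'
  field_simp

end Parabolic

end

section

open Module Matrix

variable {n r : ℕ}

/-! ### Unimodularity of `GL_n` -/

section FullAlgebra

/-- Endomorphisms of `ℝⁿ` as block triangular matrices with one block. -/
def endEquiv (n : ℕ) : End n ≃ₗ[ℝ] blockTriangularSubalgebra ℝ ℝ (fun _ : Fin n => 0) where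
  toFun p := ⟨mat p, fun _ _ h => absurd h (lt_irrefl 0)⟩
  map_add' p q := Subtype.ext (map_add mat p q)
  map_smul' c p := Subtype.ext (map_smul mat c p)
  invFun M := mat.symm M.1
  left_inv p := mat.symm_apply_apply p
  right_inv M := Subtype.ext (mat.apply_symm_apply M.1)

theorem det_toSquareBlockProp_of_forall (M : Matrix (Fin n) (Fin n) ℝ) {p : Fin n → Prop}
    [DecidablePred p] (hp : ∀ i, p i) : (toSquareBlockProp M p).det = M.det := by
  rw [← det_submatrix_equiv_self (Equiv.subtypeUnivEquiv hp) M]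
  rfl

theorem det_mulLeft_end (u : End n) : LinearMap.det (LinearMap.mulLeft ℝ u) = u.det ^ n := by
  have h : (endEquiv n).toLinearMap ∘ₗ LinearMap.mulLeft ℝ u ∘ₗ (endEquiv n).symm.toLinearMap =
      LinearMap.mulLeft ℝ (endEquiv n u) := by
    rw [← LinearMap.comp_assoc, LinearEquiv.comp_toLinearMap_symm_eq]
    exact LinearMap.ext fun q => Subtype.ext (map_mul mat u q)
  rw [← LinearMap.det_conj _ (endEquiv n), h, det_mulLeft_blockTriangular,
    Finset.prod_congr rfl fun k _ => det_toSquareBlockProp_of_forall _ fun _ => le_rfl,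
    Finset.prod_const, Finset.card_univ, Fintype.card_fin, ← det_mat]
  rfl

theorem det_mulRight_end (u : End n) : LinearMap.det (LinearMap.mulRight ℝ u) = u.det ^ n := by
  have h : (endEquiv n).toLinearMap ∘ₗ LinearMap.mulRight ℝ u ∘ₗ (endEquiv n).symm.toLinearMap =
      LinearMap.mulRight ℝ (endEquiv n u) := by
    rw [← LinearMap.comp_assoc, LinearEquiv.comp_toLinearMap_symm_eq]
    exact LinearMap.ext fun q => Subtype.ext (map_mul mat q u)
  rw [← LinearMap.det_conj _ (endEquiv n), h, det_mulRight_blockTriangular,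
    Finset.prod_congr rfl fun k _ => det_toSquareBlockProp_of_forall _ fun _ => le_rfl,
    Finset.prod_const, Finset.card_univ, Fintype.card_fin, ← det_mat]
  rfl

theorem unitsModulus_end (u : (End n)ˣ) : unitsModulus u = 1 := by
  have h := unitsDensity_inv_mul u
  rw [unitsDensity, unitsDensity] at h
  rw [unitsModulus, unitsDensity, det_mulRight_end, ← det_mulLeft_end, h]

theorem det_rotUnit (g : SO n) : (rotUnit g : End n).det = 1 := by
  have h : mat (rotUnit g : End n) = g.1 := mat.apply_symm_apply g.1
  rw [← det_mat, h]
  exact g.2.2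

end FullAlgebra

/-! ### The factorisation of `GL_n` into rotations and the parabolic group -/

section QR

/-- Every invertible endomorphism is the product of a rotation and of an endomorphism which
preserves the standard flag. -/
theorem exists_eq_rotUnit_mul (I : FlagIndex n r) (u : (End n)ˣ) :
    ∃ (g : SO n) (p : (parabolic I)ˣ), u = rotUnit g * parabolicUnit p := by
  let f : Fin n → E n := fun i => (u : End n) (EuclideanSpace.single i 1)
  have hfin : finrank ℝ (E n) = Fintype.card (Fin n) := by simp
  let b := InnerProductSpace.gramSchmidtOrthonormalBasis hfin f
  have hb : ∀ i j : Fin n, i < j → inner ℝ (b j) (f i) = 0 := fun i j hij =>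
    InnerProductSpace.gramSchmidtOrthonormalBasis_inv_triangular hfin f hij
  let K : Matrix (Fin n) (Fin n) ℝ := fun a i => b i a
  have hinner : ∀ x y : E n, inner ℝ x y = ∑ a, x a * y a := fun x y => by
    simp [PiLp.inner_apply, mul_comm]
  have hK : Kᵀ * K = 1 := by
    ext i j
    rw [mul_apply, one_apply, ← orthonormal_iff_ite.mp b.orthonormal i j, hinner]
    rfl
  have hdetK : K.det * K.det = 1 := by
    have := congrArg det hK
    rwa [det_mul, det_transpose, det_one] at this
  -- Gram–Schmidt gives determinant `±1` only. Multiplying the first column by `K.det` corrects the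
  -- sign and keeps the triangular shape; for `n = 0` there is no column and nothing to correct.
  obtain ⟨d, hd, hdK⟩ : ∃ d : Fin n → ℝ, (∀ i, d i * d i = 1) ∧ K.det * ∏ i, d i = 1 := by
    rcases Nat.eq_zero_or_pos n with rfl | hn
    · exact ⟨1, fun i => i.elim0, by simp⟩
    · refine ⟨Function.update 1 ⟨0, hn⟩ K.det, fun i => ?_, ?_⟩
      · by_cases hi : i = ⟨0, hn⟩
        · subst hi
          simpa using hdetK
        · simp [hi]
      · rw [Finset.prod_update_of_mem (Finset.mem_univ _)]
        simpa using hdetK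
  let K' := K * diagonal d
  have hK' : K'ᵀ * K' = 1 := by
    rw [transpose_mul, diagonal_transpose, Matrix.mul_assoc, ← Matrix.mul_assoc Kᵀ, hK,
      Matrix.one_mul, diagonal_mul_diagonal, funext hd]
    exact diagonal_one
  have hK'' : K' * K'ᵀ = 1 := mul_eq_one_comm.mp hK'
  have hdet : K'.det = 1 := by rw [det_mul, det_diagonal, hdK]
  let Q := K'ᵀ * mat (u : End n)
  have hQ : Q.BlockTriangular I.block := by
    intro i j hij
    -- `block` is monotone in the coordinate, so ordinary triangularity implies block triangularity.
    have hji : j < i := by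
      by_contra! h
      refine absurd hij (not_lt.mpr ?_)
      refine Finset.card_le_card fun k hk => ?_
      simp only [Finset.mem_filter, Finset.mem_univ, true_and] at hk ⊢
      exact hk.trans h
    have h1 : Q i j = d i * inner ℝ (b i) (f j) := by
      have h2 : Q i j = ∑ a, K'ᵀ i a * mat (u : End n) a j := mul_apply
      rw [h2, hinner, Finset.mul_sum]
      refine Finset.sum_congr rfl fun a _ => ?_
      have h3 : K'ᵀ i a = b i a * d i := mul_diagonal d K a i
      rw [h3, mat_apply]
      ring
    rw [h1, hb j i hji, mul_zero]
  have hmul : K' * Q = mat (u : End n) := by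
    rw [← Matrix.mul_assoc, hK'', Matrix.one_mul]
  have hQdet : IsUnit Q.det := by
    have hu : IsUnit (mat (u : End n)) := u.isUnit.map mat
    have := (isUnit_iff_isUnit_det _).mp hu
    rwa [← hmul, det_mul, hdet, one_mul] at this
  have : Invertible Q := invertibleOfIsUnitDet _ hQdet
  have hmem : ∀ M : Matrix (Fin n) (Fin n) ℝ, M.BlockTriangular I.block →
      mat.symm M ∈ parabolic I := by
    intro M hM
    change (mat (mat.symm M)).BlockTriangular I.block
    rwa [AlgEquiv.apply_symm_apply]
  let p : (parabolic I)ˣ :=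
    { val := ⟨mat.symm Q, hmem Q hQ⟩
      inv := ⟨mat.symm Q⁻¹, hmem _ (blockTriangular_inv_of_blockTriangular hQ)⟩
      val_inv := Subtype.ext (by
        change mat.symm Q * mat.symm Q⁻¹ = 1
        rw [← map_mul, mul_nonsing_inv _ hQdet, map_one])
      inv_val := Subtype.ext (by
        change mat.symm Q⁻¹ * mat.symm Q = 1
        rw [← map_mul, nonsing_inv_mul _ hQdet, map_one]) }
  let g : SO n := ⟨K', (mem_orthogonalGroup_iff (Fin n) ℝ).mpr hK'', hdet⟩
  refine ⟨g, p, Units.ext ?_⟩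
  change (u : End n) = mat.symm K' * mat.symm Q
  rw [← map_mul, hmul, AlgEquiv.symm_apply_apply]

end QR

end

section

open Module

/-! ### Measures induced on a quotient `G / P` -/

section QuotientMeasure

variable {G P S : Type*} [Group G] [MeasurableSpace G] [MeasurableMul₂ G] [Group P]
  [MeasurableSpace P] [MeasurableInv P] [Group S]

/-- Let `G = K P` with a subgroup `P`, let `w` be a weight on `G` which transforms under
translations from the right by `P` with the modulus of `P`, and let `C` be left invariant under `K`.
Then the measure `1_C w` on `G` and its translates induce the same measure on `G / P`. -/
theorem lintegral_translate_indicator_eq {m : Measure G} [SFinite m] {μ : Measure P} [SFinite μ]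
    {ι : P →* G} (hι : Measurable ι) {κ : S →* G} (hfac : ∀ x : G, ∃ k q, x = κ k * ι q)
    (hm : ∀ (g : G) (f : G → ENNReal), ∫⁻ x, f (x * g) ∂m = ∫⁻ x, f x ∂m)
    (hμl : ∀ (q : P) (f : P → ENNReal), ∫⁻ p, f (q * p) ∂μ = ∫⁻ p, f p ∂μ)
    {Δ : P → ENNReal} (hΔ : Measurable Δ) (hΔtop : ∀ p, Δ p ≠ ⊤)
    (hΔmul : ∀ p q, Δ (p * q) = Δ p * Δ q) (hΔone : Δ 1 = 1)
    (hμr : ∀ (q : P) (f : P → ENNReal), ∫⁻ p, f (p * q) ∂μ = Δ q * ∫⁻ p, f p ∂μ)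
    {w : G → ENNReal} (hw : Measurable w) (hwΔ : ∀ x p, w (x * ι p) * Δ p = w x)
    {C : Set G} (hC : MeasurableSet C) (hκ : ∀ k x, κ k * x ∈ C ↔ x ∈ C)
    (hC0 : μ (ι ⁻¹' C) ≠ 0) (hCtop : μ (ι ⁻¹' C) ≠ ⊤)
    {ψ : G → ENNReal} (hψ : Measurable ψ) (hψι : ∀ x p, ψ (x * ι p) = ψ x) (h : G) :
    ∫⁻ x, ψ x * w x * C.indicator 1 (h * x) ∂m = ∫⁻ x, ψ x * w x * C.indicator 1 x ∂m := by
  set χ : G → ENNReal := C.indicator 1 with hχ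
  have hχm : Measurable χ := measurable_one.indicator hC
  have hχκ : ∀ k x, χ (κ k * x) = χ x := fun k x => by
    by_cases hx : x ∈ C
    · rw [hχ, Set.indicator_of_mem hx, Set.indicator_of_mem ((hκ k x).mpr hx)]
      rfl
    · rw [hχ, Set.indicator_of_notMem hx, Set.indicator_of_notMem ((hκ k x).not.mpr hx)]
  -- The mass of `C` along a coset `xP` does not depend on `x`: the `κ` factor is absorbed by `C`,
  -- the `ι` factor by left invariance of `μ`.
  have hA : ∀ x, ∫⁻ p, χ (x * ι p) ∂μ = μ (ι ⁻¹' C) := by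
    intro x
    obtain ⟨k, q, rfl⟩ := hfac x
    simp only [mul_assoc, hχκ, ← map_mul]
    rw [hμl q fun p => χ (ι p), ← lintegral_indicator_one (hι hC)]
    rfl
  set F : P → ENNReal := fun p => Δ p * χ (ι p⁻¹) with hF
  -- The same for the inverted coset variable; `Δ` compensates for the right translation by `q⁻¹`.
  have hB : ∀ y, ∫⁻ p, Δ p * χ (y * ι p⁻¹) ∂μ = ∫⁻ p, F p ∂μ := by
    intro y
    obtain ⟨k, q, rfl⟩ := hfac y
    have h1 : ∀ p, Δ p * χ (κ k * ι q * ι p⁻¹) = Δ q * F (p * q⁻¹) := by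
      intro p
      rw [hF, mul_assoc, hχκ, ← map_mul]
      change _ = Δ q * (Δ (p * q⁻¹) * χ (ι (p * q⁻¹)⁻¹))
      rw [mul_inv_rev, inv_inv, ← mul_assoc, mul_comm (Δ q), ← hΔmul, inv_mul_cancel_right]
    simp only [h1]
    rw [lintegral_const_mul' _ _ (hΔtop q), hμr, ← mul_assoc, ← hΔmul, mul_inv_cancel, hΔone,
      one_mul]
  -- Insert the constant `∫ χ (x p) dp`, swap the integrals and substitute `x p⁻¹` for `x`. This
  -- leaves `ψ` unchanged and multiplies `w` by `Δ p`; the cutoff involving `g` now contains `p` and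
  -- integrates to a constant by `hB`. The right side is free of `g`.
  have key : ∀ g, μ (ι ⁻¹' C) * ∫⁻ x, ψ x * w x * χ (g * x) ∂m =
      (∫⁻ p, F p ∂μ) * ∫⁻ x, ψ x * w x * χ x ∂m := by
    intro g
    have m1 : Measurable fun z : G × P => ι z.2 := hι.comp measurable_snd
    have m2 : Measurable fun z : G × P => ι z.2⁻¹ := hι.comp measurable_snd.inv
    calc μ (ι ⁻¹' C) * ∫⁻ x, ψ x * w x * χ (g * x) ∂m
        = ∫⁻ x, ∫⁻ p, ψ x * w x * χ (g * x) * χ (x * ι p) ∂μ ∂m := by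
          rw [← lintegral_const_mul' _ _ hCtop]
          refine lintegral_congr fun x => ?_
          have h1 : Measurable fun p => χ (x * ι p) := hχm.comp (hι.const_mul x)
          rw [lintegral_const_mul _ h1, hA, mul_comm]
      _ = ∫⁻ p, ∫⁻ x, ψ x * w x * χ (g * x) * χ (x * ι p) ∂m ∂μ := by
          refine lintegral_lintegral_swap (Measurable.aemeasurable ?_)
          exact (((hψ.comp measurable_fst).mul (hw.comp measurable_fst)).mul
            (hχm.comp (measurable_fst.const_mul g))).mul (hχm.comp (measurable_fst.mul m1))
      _ = ∫⁻ p, ∫⁻ x, ψ x * w x * χ x * (Δ p * χ (g * x * ι p⁻¹)) ∂m ∂μ := by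
          refine lintegral_congr fun p => ?_
          rw [← hm (ι p⁻¹)]
          refine lintegral_congr fun x => ?_
          have h1 : w (x * ι p⁻¹) = w x * Δ p := by
            rw [← hwΔ (x * ι p⁻¹) p, mul_assoc x, ← map_mul, inv_mul_cancel, map_one, mul_one]
          rw [hψι, h1, mul_assoc x, ← map_mul, inv_mul_cancel, map_one, mul_one, ← mul_assoc g]
          ring
      _ = ∫⁻ x, ∫⁻ p, ψ x * w x * χ x * (Δ p * χ (g * x * ι p⁻¹)) ∂μ ∂m := by
          refine (lintegral_lintegral_swap (Measurable.aemeasurable ?_)).symm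
          exact (((hψ.comp measurable_fst).mul (hw.comp measurable_fst)).mul
            (hχm.comp measurable_fst)).mul ((hΔ.comp measurable_snd).mul
              (hχm.comp ((measurable_fst.const_mul g).mul m2)))
      _ = (∫⁻ p, F p ∂μ) * ∫⁻ x, ψ x * w x * χ x ∂m := by
          have h1 : Measurable fun x => ψ x * w x * χ x := (hψ.mul hw).mul hχm
          rw [← lintegral_const_mul _ h1]
          refine lintegral_congr fun x => ?_
          have h2 : Measurable fun p => Δ p * χ (g * x * ι p⁻¹) :=
            hΔ.mul (hχm.comp ((hι.comp measurable_inv).const_mul _))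
          rw [lintegral_const_mul _ h2, hB, mul_comm]
  have h1 := key 1
  simp only [one_mul] at h1
  exact (ENNReal.mul_right_inj hC0 hCtop).mp ((key h).trans h1.symm)

end QuotientMeasure

/-! ### The rotation-invariant set of frames -/

section UnitsInstances

variable {A : Type*} [NormedRing A] [NormedAlgebra ℝ A] [MeasurableSpace A] [BorelSpace A]
  [CompleteSpace A] [FiniteDimensional ℝ A]

theorem measurableMul₂_units : MeasurableMul₂ Aˣ := inferInstance

theorem measurableInv_units : MeasurableInv Aˣ := inferInstance

theorem measurable_unitsModulus : Measurable (unitsModulus : Aˣ → ENNReal) := by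
  have : Continuous fun a : A => LinearMap.toContinuousLinearMap (LinearMap.mulRight ℝ a) :=
    LinearMap.continuous_of_finiteDimensional
      (LinearMap.toContinuousLinearMap.toLinearMap ∘ₗ (LinearMap.mul ℝ A).flip)
  have h2 : Continuous fun a : A => LinearMap.det (LinearMap.mulRight ℝ a) :=
    ContinuousLinearMap.continuous_det.comp this
  exact (measurable_unitsDensity.comp measurable_inv).mul ((h2.measurable.comp
    measurableEmbedding_units_val.measurable).inv.norm).ennreal_ofReal

theorem unitsModulus_ne_top (u : Aˣ) : unitsModulus u ≠ ⊤ :=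
  ENNReal.mul_ne_top ENNReal.ofReal_ne_top ENNReal.ofReal_ne_top

theorem continuous_abs_det_mulLeft_units :
    Continuous fun u : Aˣ => |LinearMap.det (LinearMap.mulLeft ℝ (u : A))| :=
  (continuous_det_mulLeft.comp Units.continuous_val).abs

theorem unitsDensity_le_two {u : Aˣ}
    (h : 1 / 2 < |LinearMap.det (LinearMap.mulLeft ℝ (u : A))|) : unitsDensity u ≤ 2 := by
  rw [unitsDensity, abs_inv]
  refine ENNReal.ofReal_le_of_le_toReal ?_
  rw [inv_le_comm₀ (by linarith) (by simp)]
  simpa using h.le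

end UnitsInstances

variable {n r : ℕ} (I : FlagIndex n r)

theorem continuous_jac_units (F : Submodule ℝ (E n)) :
    Continuous fun u : (End n)ˣ => jac F u := by
  simp only [jac_eq_sqrt]
  refine (ContinuousLinearMap.continuous_det.comp ?_).sqrt
  have h3 : Continuous fun u : (End n)ˣ => ContinuousLinearMap.adjoint (u : End n) :=
    (ContinuousLinearMap.adjoint (𝕜 := ℝ) (E := E n) (F := E n)).continuous.comp
      Units.continuous_val
  exact continuous_const.add
    (((h3.mul Units.continuous_val).sub continuous_const).mul continuous_const)

theorem continuous_flagWeight : Continuous fun u : (End n)ˣ => flagWeight I u :=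
  (continuous_finsetProd _ fun _ _ => (continuous_jac_units _).rpow_const
    fun u => Or.inl (jac_pos _ u).ne').mul
    ((continuous_jac_units _).rpow_const fun u => Or.inl (jac_pos _ u).ne')

/-- A bounded set of invertible endomorphisms which is invariant under rotations. -/
def frames : Set (End n)ˣ :=
  {u | ‖(u : End n)‖ < 2 ∧ flagWeight I u < 2 ∧
    1 / 2 < ∏ a, jac (coordSpace n (I.ext (I.block a + 1))) (u : End n) ∧
    1 / 2 < |LinearMap.det (LinearMap.mulLeft ℝ (u : End n))|}

/-- Openness gives positive Haar mass. The norm bound and the last bound make the mass in `GL_n`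
finite, the norm bound and the third bound do so in the parabolic group, and the bound on
`flagWeight` keeps the weighted mass finite. -/
theorem isOpen_frames : IsOpen (frames I) :=
  (isOpen_lt Units.continuous_val.norm continuous_const).inter
    ((isOpen_lt (continuous_flagWeight I) continuous_const).inter
      ((isOpen_lt continuous_const (continuous_finsetProd _ fun _ _ =>
        continuous_jac_units _)).inter
        (isOpen_lt continuous_const continuous_abs_det_mulLeft_units)))

theorem jac_one (F : Submodule ℝ (E n)) : jac F (1 : End n) = 1 :=
  jac_of_isometry F (LinearIsometryEquiv.refl ℝ (E n)) _ fun _ => rfl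

theorem one_mem_frames : (1 : (End n)ˣ) ∈ frames I := by
  refine ⟨?_, ?_, ?_, ?_⟩
  · exact lt_of_le_of_lt ContinuousLinearMap.norm_id_le one_lt_two
  · simp [flagWeight, jac_one]
  · norm_num [jac_one]
  · rw [Units.val_one, LinearMap.mulLeft_one, LinearMap.det_id]
    norm_num

theorem jac_rotUnit_mul (F : Submodule ℝ (E n)) (g : SO n) (u : End n) :
    jac F (rotUnit g * u) = jac F u := by
  rw [jac_mul, jac_rotUnit, one_mul]

theorem flagWeight_rotUnit_mul (g : SO n) (u : End n) :
    flagWeight I (rotUnit g * u) = flagWeight I u := by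
  simp only [flagWeight, jac_rotUnit_mul]

theorem norm_rotUnit_mul (g : SO n) (u : End n) : ‖(rotUnit g : End n) * u‖ = ‖u‖ :=
  (rot g).toLinearIsometry.norm_toContinuousLinearMap_comp

theorem rotUnit_mul_mem_frames (g : SO n) (u : (End n)ˣ) :
    rotUnit g * u ∈ frames I ↔ u ∈ frames I := by
  have h : |LinearMap.det (LinearMap.mulLeft ℝ ((rotUnit g * u : (End n)ˣ) : End n))| =
      |LinearMap.det (LinearMap.mulLeft ℝ (u : End n))| := by
    rw [det_mulLeft_end, det_mulLeft_end, Units.val_mul, ← det_mat, map_mul, Matrix.det_mul,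
      det_mat, det_mat, det_rotUnit, one_mul]
  simp only [frames, Set.mem_ofPred_eq, h]
  simp only [Units.val_mul, norm_rotUnit_mul, flagWeight_rotUnit_mul, jac_rotUnit_mul]

theorem unitsHaar_frames_lt_top : unitsHaar (End n) (frames I) < ⊤ :=
  unitsHaar_lt_top (isOpen_frames I).measurableSet 2 (fun _ hu => hu.1.le) 2 (by simp)
    fun _ hu => unitsDensity_le_two hu.2.2.2

theorem unitsHaar_frames_pos : 0 < unitsHaar (End n) (frames I) :=
  unitsHaar_pos_of_isOpen (isOpen_frames I) ⟨1, one_mem_frames I⟩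

theorem unitsHaar_parabolic_frames_pos :
    0 < unitsHaar (parabolic I) (parabolicUnit ⁻¹' frames I) :=
  unitsHaar_pos_of_isOpen ((isOpen_frames I).preimage continuous_parabolicUnit)
    ⟨1, by
      change parabolicUnit 1 ∈ frames I
      rw [map_one]
      exact one_mem_frames I⟩

theorem unitsHaar_parabolic_frames_lt_top :
    unitsHaar (parabolic I) (parabolicUnit ⁻¹' frames I) < ⊤ :=
  unitsHaar_lt_top ((isOpen_frames I).preimage continuous_parabolicUnit).measurableSet 2
    (fun _ hu => hu.1.le) 2 (by simp) fun p hp => unitsDensity_le_two (by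
      rw [abs_det_mulLeft_parabolic]
      exact hp.2.2.1)

theorem lintegral_unitsHaar_end_mul_right (g : (End n)ˣ) (f : (End n)ˣ → ENNReal) :
    ∫⁻ u, f (u * g) ∂(unitsHaar (End n)) = ∫⁻ u, f u ∂(unitsHaar (End n)) :=
  (lintegral_unitsHaar_mul_right g f).trans (by rw [unitsModulus_end, one_mul])

theorem flagWeight_mul_unitsModulus (u : (End n)ˣ) (p : (parabolic I)ˣ) :
    ENNReal.ofReal (flagWeight I ((u * parabolicUnit p : (End n)ˣ) : End n)) * unitsModulus p =
      ENNReal.ofReal (flagWeight I (u : End n)) := by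
  have h0 := flagWeight_pos (I := I) (parabolicUnit p)
  have h1 : flagWeight I ((u * parabolicUnit p : (End n)ˣ) : End n) =
      flagWeight I (u : End n) * flagWeight I (parabolicUnit p : End n) :=
    flagWeight_mul_parabolicUnit u p
  rw [h1, unitsModulus_parabolic,
    ← ENNReal.ofReal_mul (mul_nonneg (flagWeight_pos u).le h0.le), mul_inv_cancel_right₀ h0.ne']

theorem smul_stdFlag_mul_parabolicUnit (u : (End n)ˣ) (p : (parabolic I)ˣ) :
    (u * parabolicUnit p) • stdFlag I = u • stdFlag I := by
  rw [mul_smul, parabolicUnit_smul_stdFlag]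

end

section

variable {n r : ℕ} (I : FlagIndex n r)

instance : NormedAlgebra ℝ (parabolic I) := inferInstance

instance : FiniteDimensional ℝ (parabolic I) := inferInstance

instance : BorelSpace (parabolic I) := inferInstance

theorem measurable_parabolicUnit : Measurable (parabolicUnit : (parabolic I)ˣ → (End n)ˣ) :=
  continuous_parabolicUnit.measurable

theorem measurable_unitsModulus_parabolic :
    Measurable fun p : (parabolic I)ˣ => unitsModulus p := measurable_unitsModulus

theorem lintegral_parabolic_mul_left (q : (parabolic I)ˣ) (f : (parabolic I)ˣ → ENNReal) :
    ∫⁻ p, f (q * p) ∂(unitsHaar (parabolic I)) = ∫⁻ p, f p ∂(unitsHaar (parabolic I)) :=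
  lintegral_unitsHaar_mul_left q f

theorem lintegral_parabolic_mul_right (q : (parabolic I)ˣ) (f : (parabolic I)ˣ → ENNReal) :
    ∫⁻ p, f (p * q) ∂(unitsHaar (parabolic I)) =
      unitsModulus q * ∫⁻ p, f p ∂(unitsHaar (parabolic I)) :=
  lintegral_unitsHaar_mul_right q f

theorem measurable_smul_stdFlag : Measurable fun u : (End n)ˣ => u • stdFlag I :=
  (continuous_units_smul.comp (continuous_id.prodMk continuous_const)).measurable

theorem measurable_flagWeight :
    Measurable fun u : (End n)ˣ => ENNReal.ofReal (flagWeight I (u : End n)) :=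
  (continuous_flagWeight I).measurable.ennreal_ofReal

theorem lintegral_frames_translate {φ : Flag I → ENNReal} (hφ : Measurable φ) (h : (End n)ˣ) :
    ∫⁻ u, φ (u • stdFlag I) * ENNReal.ofReal (flagWeight I (u : End n)) *
        (frames I).indicator 1 (h * u) ∂(unitsHaar (End n)) =
      ∫⁻ u, φ (u • stdFlag I) * ENNReal.ofReal (flagWeight I (u : End n)) *
        (frames I).indicator 1 u ∂(unitsHaar (End n)) := by
  have i1 := measurableMul₂_units (A := End n)
  have i2 := measurableInv_units (A := parabolic I)
  have h1 := lintegral_translate_indicator_eq (m := unitsHaar (End n))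
    (μ := unitsHaar (parabolic I)) (measurable_parabolicUnit I) (exists_eq_rotUnit_mul I)
    lintegral_unitsHaar_end_mul_right (lintegral_parabolic_mul_left I)
    (measurable_unitsModulus_parabolic I) unitsModulus_ne_top unitsModulus_mul
    unitsModulus_one (lintegral_parabolic_mul_right I) (measurable_flagWeight I)
    (flagWeight_mul_unitsModulus I) (isOpen_frames I).measurableSet (rotUnit_mul_mem_frames I)
    (unitsHaar_parabolic_frames_pos I).ne' (unitsHaar_parabolic_frames_lt_top I).ne
    (hφ.comp (measurable_smul_stdFlag I))
    (fun u p => congrArg φ (smul_stdFlag_mul_parabolicUnit I u p)) h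
  exact h1

end

/-! ### The flag measure as a quotient measure and the change of variables -/

section

open Module

variable {n r : ℕ} (I : FlagIndex n r)

/-- A right translate of the Haar probability measure is again a Haar probability measure, hence
equal to it. -/
theorem lintegral_haarSO_mul_right (g : SO n) {f : SO n → ENNReal} (hf : Measurable f) :
    ∫⁻ k, f (k * g) ∂(haarSO n) = ∫⁻ k, f k ∂(haarSO n) := by
  have hg : Measurable fun k : SO n => k * g := (continuous_mul_const g).measurable
  have : IsProbabilityMeasure ((haarSO n).map fun k => k * g) :=
    Measure.isProbabilityMeasure_map hg.aemeasurable
  have h : (haarSO n).map (fun k => k * g) = haarSO n :=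
    Measure.isHaarMeasure_eq_of_isProbabilityMeasure _ _
  rw [← lintegral_map hf hg, h]

/-- Write `u = g p`: the factor `p` fixes the standard flag and `g` disappears by right invariance.
Averaging over rotations thus forgets `u`. -/
theorem lintegral_haarSO_smul {φ : Flag I → ENNReal} (hφ : Measurable φ) (u : (End n)ˣ) :
    ∫⁻ k, φ ((rotUnit k * u) • stdFlag I) ∂(haarSO n) = ∫⁻ ξ, φ ξ ∂(flagMeasure I) := by
  obtain ⟨g, p, rfl⟩ := exists_eq_rotUnit_mul I u
  have h : ∀ k, (rotUnit k * (rotUnit g * parabolicUnit p)) • stdFlag I = (k * g) • stdFlag I := by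
    intro k
    rw [← mul_assoc, ← map_mul, smul_stdFlag_mul_parabolicUnit, rotUnit_smul]
  simp only [h]
  rw [flagMeasure, lintegral_map hφ (measurable_orbit _)]
  exact lintegral_haarSO_mul_right g (hφ.comp (measurable_orbit (stdFlag I)))

/-- The mass of the weighted set of frames. -/
def framesMass : ENNReal :=
  ∫⁻ u, ENNReal.ofReal (flagWeight I (u : End n)) * (frames I).indicator 1 u ∂(unitsHaar (End n))

theorem framesMass_ne_top : framesMass I ≠ ⊤ := by
  refine ne_top_of_le_ne_top
    (ENNReal.mul_ne_top ENNReal.ofNat_ne_top (unitsHaar_frames_lt_top I).ne) (b := 2 * _) ?_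
  rw [← lintegral_indicator_one (isOpen_frames I).measurableSet,
    ← lintegral_const_mul' _ _ ENNReal.ofNat_ne_top, framesMass]
  refine lintegral_mono fun u => ?_
  by_cases hu : u ∈ frames I
  · refine mul_le_mul_left (ENNReal.ofReal_le_of_le_toReal ?_) _
    simpa using hu.2.1.le
  · rw [Set.indicator_of_notMem hu, mul_zero]
    exact zero_le

theorem measurable_framesIndicator :
    Measurable ((frames I).indicator 1 : (End n)ˣ → ENNReal) :=
  measurable_one.indicator (isOpen_frames I).measurableSet

theorem framesMass_ne_zero : framesMass I ≠ 0 := by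
  refine (lintegral_pos_iff_support
    ((measurable_flagWeight I).mul (measurable_framesIndicator I))).mpr ?_ |>.ne'
  refine (unitsHaar_frames_pos I).trans_le (measure_mono fun u hu => ?_)
  rw [Function.mem_support, Pi.mul_apply, Set.indicator_of_mem hu]
  simpa using flagWeight_pos u

theorem framesIndicator_rotUnit_mul (k : SO n) (u : (End n)ˣ) :
    (frames I).indicator (1 : (End n)ˣ → ENNReal) (rotUnit k * u) = (frames I).indicator 1 u := by
  by_cases hu : u ∈ frames I
  · rw [Set.indicator_of_mem hu, Set.indicator_of_mem ((rotUnit_mul_mem_frames I k u).mpr hu)]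
    rfl
  · rw [Set.indicator_of_notMem hu,
      Set.indicator_of_notMem ((rotUnit_mul_mem_frames I k u).not.mpr hu)]

theorem continuous_rotUnit : Continuous (rotUnit : SO n → (End n)ˣ) := by
  have h : ∀ f : SO n → SO n, Continuous f → Continuous fun g => (rotUnit (f g) : End n) :=
    fun f hf => (continuous_toEuclideanCLM n).comp (continuous_subtype_val.comp hf)
  refine Units.continuous_iff.mpr ⟨h id continuous_id, ?_⟩
  have h2 := h _ continuous_inv
  simpa only [map_inv] using h2

/-- The weighted set of frames induces a multiple of the flag measure. -/
theorem lintegral_frames {φ : Flag I → ENNReal} (hφ : Measurable φ) :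
    ∫⁻ u, φ (u • stdFlag I) * ENNReal.ofReal (flagWeight I (u : End n)) *
        (frames I).indicator 1 u ∂(unitsHaar (End n)) =
      framesMass I * ∫⁻ ξ, φ ξ ∂(flagMeasure I) := by
  have i1 := measurableMul₂_units (A := End n)
  -- Rotations from the left change neither the Haar measure, nor the weight, nor the set of frames,
  -- so the integral may be averaged over `k`.
  have hrot : ∀ k : SO n, ∫⁻ u, φ (u • stdFlag I) * ENNReal.ofReal (flagWeight I (u : End n)) *
        (frames I).indicator 1 u ∂(unitsHaar (End n)) =
      ∫⁻ u, φ ((rotUnit k * u) • stdFlag I) * (ENNReal.ofReal (flagWeight I (u : End n)) *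
        (frames I).indicator 1 u) ∂(unitsHaar (End n)) := by
    intro k
    rw [← lintegral_unitsHaar_mul_left (rotUnit k)]
    refine lintegral_congr fun u => ?_
    rw [framesIndicator_rotUnit_mul, Units.val_mul, flagWeight_rotUnit_mul, mul_assoc]
  have hmeas : Measurable fun z : SO n × (End n)ˣ => φ ((rotUnit z.1 * z.2) • stdFlag I) :=
    hφ.comp ((measurable_smul_stdFlag I).comp
      ((continuous_rotUnit.measurable.comp measurable_fst).mul measurable_snd))
  have hw : Measurable fun u : (End n)ˣ => ENNReal.ofReal (flagWeight I (u : End n)) *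
      (frames I).indicator 1 u :=
    (measurable_flagWeight I).mul (measurable_framesIndicator I)
  calc ∫⁻ u, φ (u • stdFlag I) * ENNReal.ofReal (flagWeight I (u : End n)) *
        (frames I).indicator 1 u ∂(unitsHaar (End n))
      = ∫⁻ _ : SO n, (∫⁻ u, φ (u • stdFlag I) * ENNReal.ofReal (flagWeight I (u : End n)) *
        (frames I).indicator 1 u ∂(unitsHaar (End n))) ∂(haarSO n) := by
        rw [lintegral_const, measure_univ, mul_one]
    _ = ∫⁻ k, ∫⁻ u, φ ((rotUnit k * u) • stdFlag I) * (ENNReal.ofReal (flagWeight I (u : End n)) *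
        (frames I).indicator 1 u) ∂(unitsHaar (End n)) ∂(haarSO n) := lintegral_congr hrot
    _ = ∫⁻ u, ∫⁻ k, φ ((rotUnit k * u) • stdFlag I) * (ENNReal.ofReal (flagWeight I (u : End n)) *
        (frames I).indicator 1 u) ∂(haarSO n) ∂(unitsHaar (End n)) :=
        lintegral_lintegral_swap (hmeas.mul (hw.comp measurable_snd)).aemeasurable
    _ = ∫⁻ u, (ENNReal.ofReal (flagWeight I (u : End n)) * (frames I).indicator 1 u) *
          ∫⁻ ξ, φ ξ ∂(flagMeasure I) ∂(unitsHaar (End n)) := by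
        refine lintegral_congr fun u => ?_
        have h1 : Measurable fun k : SO n => φ ((rotUnit k * u) • stdFlag I) :=
          hφ.comp ((measurable_smul_stdFlag I).comp (continuous_rotUnit.measurable.mul_const u))
        rw [lintegral_mul_const _ h1, lintegral_haarSO_smul I hφ, mul_comm]
    _ = framesMass I * ∫⁻ ξ, φ ξ ∂(flagMeasure I) := lintegral_mul_const _ hw

/-- The density of the image of the flag measure under the inverse of `h`. -/
def flagJac (h : (End n)ˣ) (ξ : Flag I) : ENNReal :=
  ∏ j : Fin r, ENNReal.ofReal (jac (ξ.space j) h) ^ ((I.ext j : ℝ) - I.ext (j + 2))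

theorem measurable_flagJac (h : (End n)ˣ) : Measurable (flagJac I h) :=
  Finset.measurable_fun_prod _ fun j _ =>
    (((continuous_jac j).comp (continuous_const.prodMk continuous_id)).measurable.ennreal_ofReal).pow_const _

theorem flagJac_lt_top (h : (End n)ˣ) (ξ : Flag I) : flagJac I h ξ < ⊤ :=
  ENNReal.prod_lt_top fun j _ =>
    (ENNReal.rpow_ne_top_of_ne_zero (by simpa using jac_pos _ h) ENNReal.ofReal_ne_top).lt_top

/-- Chain rule on each space of the flag; the top factor of the weight is unchanged because `|det h|
= 1`. -/
theorem flagJac_mul_flagWeight {h : (End n)ˣ} (hh : |(h : End n).det| = 1) (u : (End n)ˣ) :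
    flagJac I h (u • stdFlag I) * ENNReal.ofReal (flagWeight I (u : End n)) =
      ENNReal.ofReal (flagWeight I ((h * u : (End n)ˣ) : End n)) := by
  have h1 : jac (coordSpace n (I.ext (r + 1))) ((h * u : (End n)ˣ) : End n) =
      jac (coordSpace n (I.ext (r + 1))) (u : End n) := by
    rw [Units.val_mul, I.ext_last, jac_coordSpace_top, jac_coordSpace_top, ← det_mat, map_mul,
      Matrix.det_mul, abs_mul, det_mat, det_mat, hh, one_mul]
  have h2 : flagJac I h (u • stdFlag I) = ENNReal.ofReal (∏ j : Fin r,
      jac ((coordSpace n (I.ext (j + 1))).map (u : End n).toLinearMap) (h : End n) ^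
        ((I.ext j : ℝ) - I.ext (j + 2))) := by
    rw [flagJac, ENNReal.ofReal_prod_of_nonneg
      fun j _ => (Real.rpow_pos_of_pos (jac_pos _ h) _).le]
    refine Finset.prod_congr rfl fun j _ => ?_
    rw [ENNReal.ofReal_rpow_of_pos (jac_pos _ h), units_smul_space, stdFlag_space]
  rw [h2, ← ENNReal.ofReal_mul
    (Finset.prod_nonneg fun j _ => (Real.rpow_pos_of_pos (jac_pos _ h) _).le),
    flagWeight, flagWeight, h1, ← mul_assoc, ← Finset.prod_mul_distrib]
  congr 2
  refine Finset.prod_congr rfl fun j _ => ?_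
  rw [Units.val_mul, jac_mul, Real.mul_rpow (jac_pos _ h).le (jac_pos _ u).le]

/-- Change of variables on the flag manifold. -/
theorem lintegral_flagJac_mul {h : (End n)ˣ} (hh : |(h : End n).det| = 1) {φ : Flag I → ENNReal}
    (hφ : Measurable φ) :
    ∫⁻ ξ, flagJac I h ξ * φ (h • ξ) ∂(flagMeasure I) = ∫⁻ ξ, φ ξ ∂(flagMeasure I) := by
  have hact : Measurable fun ξ : Flag I => h • ξ := (continuous_const_smul h).measurable
  refine (ENNReal.mul_right_inj (framesMass_ne_zero I) (framesMass_ne_top I)).mp ?_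
  have hmeas : Measurable fun ξ => flagJac I h ξ * φ (h • ξ) :=
    (measurable_flagJac I h).mul (hφ.comp hact)
  -- Both sides are lifted to `GL_n`. On the right the frames are replaced by a translate under `h`,
  -- which the substitution `u ↦ h u` undoes; the weight `w(hu)` it leaves is the one that `flagJac`
  -- produces on the left.
  rw [← lintegral_frames I hmeas, ← lintegral_frames I hφ,
    ← lintegral_frames_translate I hφ h⁻¹]
  refine Eq.trans ?_ (lintegral_unitsHaar_mul_left h _)
  refine lintegral_congr fun u => ?_
  rw [← flagJac_mul_flagWeight I hh, inv_mul_cancel_left, mul_smul]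
  ring

/-- Change of variables on the flag manifold, for functions which need not be measurable. -/
theorem lintegral_flagJac_mul_of_not_measurable {h : (End n)ˣ} (hh : |(h : End n).det| = 1)
    (φ : Flag I → ENNReal) :
    ∫⁻ ξ, flagJac I h ξ * φ (h • ξ) ∂(flagMeasure I) = ∫⁻ ξ, φ ξ ∂(flagMeasure I) := by
  let e : Flag I ≃ᵐ Flag I := (Homeomorph.smul h).toMeasurableEquiv
  -- The formula for indicators is an identity of measures. It extends to all functions because `e`
  -- is a measurable equivalence and the density is measurable and finite.
  have hmap : ((flagMeasure I).withDensity (flagJac I h)).map e = flagMeasure I := by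
    ext s hs
    have h1 := lintegral_flagJac_mul I hh (φ := s.indicator 1) (measurable_one.indicator hs)
    rw [lintegral_indicator_one hs] at h1
    rw [e.map_apply, withDensity_apply _ (e.measurable hs), ← h1,
      ← lintegral_indicator (e.measurable hs)]
    refine lintegral_congr fun ξ => ?_
    by_cases hξ : h • ξ ∈ s
    · rw [Set.indicator_of_mem hξ, Set.indicator_of_mem (show ξ ∈ e ⁻¹' s from hξ)]
      simp
    · rw [Set.indicator_of_notMem hξ, Set.indicator_of_notMem (show ξ ∉ e ⁻¹' s from hξ), mul_zero]
  conv_rhs => rw [← hmap]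
  rw [lintegral_map_equiv, lintegral_withDensity_eq_lintegral_mul_non_measurable _
    (measurable_flagJac I h) (ae_of_all _ (flagJac_lt_top I h))]
  rfl

end

section

open Module

variable {n r : ℕ} (I : FlagIndex n r)

/-! ### Homogeneity under dilations -/

section Scaling

theorem mul_rpow_of_ne_zero_of_ne_top {c : ENNReal} (h0 : c ≠ 0) (ht : c ≠ ⊤) (x : ENNReal) (z : ℝ) :
    (c * x) ^ z = c ^ z * x ^ z := by
  simp [ENNReal.mul_rpow_eq_ite, h0, ht]

open scoped Pointwise in
theorem projVol_smul_image (F : Submodule ℝ (E n)) {lam : ℝ} (hlam : 0 < lam) (L : Set (E n)) :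
    projVol F ((lam • ·) '' L) = ENNReal.ofReal lam ^ (finrank ℝ F : ℝ) * projVol F L := by
  have h : F.orthogonalProjectionOnto '' ((lam • ·) '' L) =
      lam • (F.orthogonalProjectionOnto '' L) := by
    rw [Set.image_image, ← Set.image_smul, Set.image_image]
    exact Set.image_congr fun x _ => map_smul _ _ _
  rw [projVol, h, Measure.addHaar_smul, abs_of_pos (pow_pos hlam _), ENNReal.rpow_natCast,
    ENNReal.ofReal_pow hlam.le, projVol]

/-- The summands are differences of consecutive terms `i_k i_{k+1}`, and `i_0 = 0`. -/
theorem FlagIndex.sum_mul_exponent :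
    ∑ j : Fin r, (I.ext (j + 1) : ℝ) * ((I.ext j : ℝ) - I.ext (j + 2)) =
      -((I.ext r : ℝ) * n) := by
  have h := Finset.sum_range_sub' (fun k => (I.ext k : ℝ) * I.ext (k + 1)) r
  rw [I.ext_last, I.ext_zero, Nat.cast_zero, zero_mul, zero_sub] at h
  rw [← h, ← Fin.sum_univ_eq_sum_range
    (fun k => (I.ext k : ℝ) * I.ext (k + 1) - (I.ext (k + 1) : ℝ) * I.ext (k + 1 + 1)) r]
  exact Finset.sum_congr rfl fun j _ => by ring

/-- For `r = 0` the index `I.ext r` would be `i_0 = 0` and homogeneity would fail. -/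
theorem FlagIndex.exponent_ne_zero (hr : 1 ≤ r) : (I.ext r : ℝ) * n ≠ 0 := by
  obtain ⟨k, rfl⟩ : ∃ k, r = k + 1 := ⟨r - 1, by omega⟩
  rw [I.ext_succ_of_lt (Nat.lt_succ_self k)]
  have h1 := I.one_le ⟨k, Nat.lt_succ_self k⟩
  have h2 := I.lt ⟨k, Nat.lt_succ_self k⟩
  exact mul_ne_zero (Nat.cast_ne_zero.mpr (by omega)) (Nat.cast_ne_zero.mpr (by omega))

theorem flagQuermass_smul_image (hr : 1 ≤ r) {lam : ℝ} (hlam : 0 < lam) (L : Set (E n)) :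
    flagQuermass I ((lam • ·) '' L) = ENNReal.ofReal lam * flagQuermass I L := by
  have h0 : ENNReal.ofReal lam ≠ 0 := by simpa using hlam
  have ht : ENNReal.ofReal lam ≠ ⊤ := ENNReal.ofReal_ne_top
  have hp0 : ∀ z : ℝ, ENNReal.ofReal lam ^ z ≠ 0 := fun z => by simp [ENNReal.rpow_eq_zero_iff, h0, ht]
  have hpt : ∀ z : ℝ, ENNReal.ofReal lam ^ z ≠ ⊤ := fun z => ENNReal.rpow_ne_top_of_ne_zero h0 ht
  have hprod : ∀ ξ : Flag I, ∏ j : Fin r,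
      projVol (ξ.space j) ((lam • ·) '' L) ^ ((I.ext j : ℝ) - (I.ext (j + 2) : ℝ)) =
      ENNReal.ofReal lam ^ (-((I.ext r : ℝ) * n)) * ∏ j : Fin r,
        projVol (ξ.space j) L ^ ((I.ext j : ℝ) - (I.ext (j + 2) : ℝ)) := by
    intro ξ
    have hsum : ∀ (s : Finset (Fin r)) (e : Fin r → ℝ),
        ∏ j ∈ s, ENNReal.ofReal lam ^ e j = ENNReal.ofReal lam ^ (∑ j ∈ s, e j) := by
      intro s e
      induction s using Finset.cons_induction with
      | empty => simp
      | cons a s ha ih => rw [Finset.prod_cons, Finset.sum_cons, ih, ENNReal.rpow_add _ _ h0 ht]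
    rw [← I.sum_mul_exponent, ← hsum, ← Finset.prod_mul_distrib]
    refine Finset.prod_congr rfl fun j _ => ?_
    rw [projVol_smul_image _ hlam, mul_rpow_of_ne_zero_of_ne_top (hp0 _) (hpt _), ← ENNReal.rpow_mul,
      ξ.finrank_eq, I.ext_succ]
  rw [flagQuermass, lintegral_congr hprod, lintegral_const_mul' _ _ (hpt _),
    mul_rpow_of_ne_zero_of_ne_top (hp0 _) (hpt _), ← ENNReal.rpow_mul, flagQuermass]
  congr 1
  have h1 := I.exponent_ne_zero hr
  rw [neg_mul_neg, mul_one_div_cancel h1, ENNReal.rpow_one]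

theorem flagQuermassFun_dilate (hr : 1 ≤ r) (f : E n → ENNReal) {lam : ℝ} (hlam : 0 < lam) :
    flagQuermassFun I (dilate lam f) = ENNReal.ofReal lam * flagQuermassFun I f := by
  rw [flagQuermassFun, flagQuermassFun, ← lintegral_const_mul' _ _ ENNReal.ofReal_ne_top]
  refine lintegral_congr fun t => ?_
  rw [← flagQuermass_smul_image I hr hlam]
  congr 1
  ext x
  constructor
  · intro hx
    exact ⟨lam⁻¹ • x, hx, smul_inv_smul₀ hlam.ne' x⟩
  · rintro ⟨y, hy, rfl⟩
    change ENNReal.ofReal t ≤ f (lam⁻¹ • lam • y)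
    rw [inv_smul_smul₀ hlam.ne']
    exact hy

end Scaling

/-! ### Invariance under volume-preserving affine maps -/

section Affine

theorem projVol_add_image (F : Submodule ℝ (E n)) (v : E n) (L : Set (E n)) :
    projVol F ((· + v) '' L) = projVol F L := by
  have h : F.orthogonalProjectionOnto '' ((· + v) '' L) =
      (· + F.orthogonalProjectionOnto v) '' (F.orthogonalProjectionOnto '' L) := by
    rw [Set.image_image, Set.image_image]
    exact Set.image_congr fun x _ => map_add _ _ _
  rw [projVol, h, Set.image_add_right, measure_preimage_add_right, projVol]

theorem flagQuermass_add_image (v : E n) (L : Set (E n)) :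
    flagQuermass I ((· + v) '' L) = flagQuermass I L := by
  simp only [flagQuermass, projVol_add_image]

/-- Each factor `|P_{F_j} h*L|` splits into a Jacobian and `|P_{hF_j} L|`. The Jacobians multiply to
`flagJac`, which the change of variables `ξ ↦ hξ` absorbs. -/
theorem flagQuermass_adjoint_image {h : (End n)ˣ} (hh : |(h : End n).det| = 1) (L : Set (E n)) :
    flagQuermass I (ContinuousLinearMap.adjoint (h : End n) '' L) = flagQuermass I L := by
  rw [flagQuermass, flagQuermass]
  congr 1
  refine Eq.trans ?_ (lintegral_flagJac_mul_of_not_measurable I hh _)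
  refine lintegral_congr fun ξ => ?_
  rw [flagJac, ← Finset.prod_mul_distrib]
  refine Finset.prod_congr rfl fun j _ => ?_
  rw [projVol_adjoint_image, mul_rpow_of_ne_zero_of_ne_top (by simpa using jac_pos _ h)
    ENNReal.ofReal_ne_top, units_smul_space]

/-- Every `u` is the adjoint of `star u`, which has the same determinant. -/
theorem flagQuermass_linear_image {u : (End n)ˣ} (hu : |(u : End n).det| = 1) (L : Set (E n)) :
    flagQuermass I ((u : End n) '' L) = flagQuermass I L := by
  have h1 : ((star u : (End n)ˣ) : End n) = ContinuousLinearMap.adjoint (u : End n) := rfl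
  have h2 := flagQuermass_adjoint_image I (h := star u) (by rw [h1, det_adjoint, hu]) L
  rwa [h1, ContinuousLinearMap.adjoint_adjoint] at h2

theorem affine_image_eq (T : E n ≃ᵃ[ℝ] E n) (L : Set (E n)) :
    T '' L = (· + T 0) '' (T.linear '' L) := by
  rw [Set.image_image]
  refine Set.image_congr fun x _ => ?_
  have h := T.map_vadd 0 x
  simpa using h

/-- The image of the unit ball has the volume of the ball, which is positive and finite, and also
`|det|` times that volume. -/
theorem abs_det_linear_of_measurePreserving {T : E n ≃ᵃ[ℝ] E n}
    (hT : MeasurePreserving T volume volume) : |LinearMap.det T.linear.toLinearMap| = 1 := by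
  have hb : T '' Metric.ball 0 1 = T.symm ⁻¹' Metric.ball 0 1 := by
    ext x
    constructor
    · rintro ⟨y, hy, rfl⟩
      simpa using hy
    · intro hx
      exact ⟨T.symm x, hx, T.apply_symm_apply x⟩
  have hm : MeasurableSet (T '' Metric.ball 0 1) := by
    rw [hb]
    exact Metric.isOpen_ball.measurableSet.preimage
      (AffineMap.continuous_of_finiteDimensional T.symm.toAffineMap).measurable
  have h1 := hT.measure_preimage hm.nullMeasurableSet
  rw [Set.preimage_image_eq _ T.injective, affine_image_eq, Set.image_add_right,
    measure_preimage_add_right] at h1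
  have h2 : volume (T.linear '' Metric.ball (0 : E n) 1) =
      ENNReal.ofReal |LinearMap.det T.linear.toLinearMap| * volume (Metric.ball (0 : E n) 1) :=
    Measure.addHaar_image_linearMap volume T.linear.toLinearMap _
  rw [h2] at h1
  have h3 : volume (Metric.ball (0 : E n) 1) ≠ 0 := (Metric.measure_ball_pos _ _ one_pos).ne'
  have h4 : volume (Metric.ball (0 : E n) 1) ≠ ⊤ := measure_ball_lt_top.ne
  have h5 : ENNReal.ofReal |LinearMap.det T.linear.toLinearMap| = 1 :=
    ((ENNReal.mul_left_inj h3 h4).mp ((one_mul _).trans h1)).symm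
  exact ENNReal.ofReal_eq_one.mp h5

theorem flagQuermass_affine_image {T : E n ≃ᵃ[ℝ] E n} (hT : MeasurePreserving T volume volume)
    (L : Set (E n)) : flagQuermass I (T '' L) = flagQuermass I L := by
  let u : (End n)ˣ := (ContinuousLinearEquiv.unitsEquiv ℝ (E n)).symm
    T.linear.toContinuousLinearEquiv
  rw [affine_image_eq, flagQuermass_add_image]
  exact flagQuermass_linear_image I (u := u) (abs_det_linear_of_measurePreserving hT) L

theorem flagQuermassFun_affComp {T : E n ≃ᵃ[ℝ] E n} (hT : MeasurePreserving T volume volume)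
    (f : E n → ENNReal) : flagQuermassFun I (affComp f T) = flagQuermassFun I f := by
  rw [flagQuermassFun, flagQuermassFun]
  refine lintegral_congr fun t => ?_
  refine Eq.trans ?_ (flagQuermass_affine_image I hT _)
  congr 1
  ext x
  constructor
  · intro hx
    exact ⟨T.symm x, hx, T.apply_symm_apply x⟩
  · rintro ⟨y, hy, rfl⟩
    change ENNReal.ofReal t ≤ f (T.symm (T y))
    rw [T.symm_apply_apply]
    exact hy

end Affine

end

end FlagQuermass

end

theorem mainTheorem10 {n r : ℕ} (hr : 1 ≤ r) (I : FlagQuermass.FlagIndex n r)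
    (f : FlagQuermass.E n → ENNReal) :
    (∀ lam : ℝ, 0 < lam →
      FlagQuermass.flagQuermassFun I (FlagQuermass.dilate lam f) =
        ENNReal.ofReal lam * FlagQuermass.flagQuermassFun I f) ∧
    (∀ T : FlagQuermass.E n ≃ᵃ[ℝ] FlagQuermass.E n,
      MeasureTheory.MeasurePreserving T MeasureTheory.volume MeasureTheory.volume →
      FlagQuermass.flagQuermassFun I (FlagQuermass.affComp f T) =
        FlagQuermass.flagQuermassFun I f) := by
  exact ⟨fun _ hlam => FlagQuermass.flagQuermassFun_dilate I hr f hlam,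
    fun _ hT => FlagQuermass.flagQuermassFun_affComp I hT f⟩
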